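/- **Setting.** A curve is a nonempty finite sequence of points of $\mathbb{R}$. For curves $P=(p_0,\dots,p_{n-1})$ and $Q=(q_0,\dots,q_{m-1})$, $\mathrm{DTW}(P,Q)$ is the minimum of $\sum_{(i,j)\in\pi}|p_i-q_j|$ over all grid paths $\pi$ from $(0,0)$ to $(n-1,m-1)$ with steps $(1,0)$, $(0,1)$, $(1,1)$. A *dynamic DTW data structure* preprocesses two curves $P,Q$ and then supports substitutions of a vertex of $Q$ by an arbitrary real, and queries that return $\mathrm{DTW}(P,Q)$. An instance of *Intermediary* of size $n_r\times n_c$ ($n_r,n_c\ge 1$) consists of non-negative integers $r_i,d_i$ ($0\le i<n_r$) and $c_j$ ($0\le j<n_c$), Booleans $b_j$ ($0\le j<n_c$), and an integer $U>n_r n_c(\max_i d_i\cdot\max_i r_i\cdot\max_j c_j)^2$. It defines a directed $n_r\times n_c$ grid: edges $(i,j)\to(i,j+1)$ and $(i,j)\to(i+1,j)$ have weight $U$, and the edge $(i,j)\to(i+1,j+1)$ has weight $d_ib_j$ if $r_i=c_j$ and $\sqrt U$ otherwise. An update sets one $b_j$ to $0$ or $1$. A query returns the length $L$ of a shortest path from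 $(0,0)$ to $(n_r-1,n_c-1)$ if $L<U|n_r-n_c|+\sqrt U$, and $\infty$ otherwise. Running times are worst-case numbers of steps on a real RAM: unit-cost $+,-,\times,\div$ and comparisons on integers (integer subtraction truncated at $0$, integer division rounded down) and on reals, conversion of integers to reals, and arrays with indirect addressing. A data structure is a triple of programs (preprocessing, update, query) that is correct on every input, for every sequence of operations. **Theorem.** There are functions $\nu,\mu:\mathbb{N}\to\mathbb{N}$ and a constant $C$ with $\nu(k)\le Ck$ and $\mu(k)\le Ck$ for all $k\ge 1$ such that the following hold. 1. *(Data structures.)* Let $T_P,T_U,T_Q:\mathbb{N}\times\mathbb{N}\to\mathbb{N}$, and suppose that some dynamic DTW data structure has preprocessing, update and query times at most $T_P(n,m)$, $T_U(n,m)$, $T_Q(n,m)$ for all curves $P,Q$, where $n=|P|$ and $m=|Q|$. Then there is a data structure for Intermediary that on every instance of size $n_r\times n_c$ has preprocessing time at most $C\,(T_P(n,m)+n+m)$, update time at most $C\,T_U(n,m)$ and query time at most $C\,T_Q(n,m)$, where $n=\nu(n_r)=O(n_r)$ and $m=\mu(n_c)=O(n_c)$. 2. *(Curves.)* For an integer $V$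 let $\star^8$ be the point $-V^5$ repeated eight times. Let $P$ be $\star^8$ followed, for $i=0,\dots,n_r-2$, by $$\star^8,\; V^4+2r_iV^3+\tfrac{d_i}4,\; 2V^4+2r_iV^3-\tfrac{d_i}4,\; 3V^4-2r_iV^3+\tfrac{d_i}4,\; 4V^4-2r_iV^3-\tfrac{d_i}4,\;\star^8,$$ and let $Q$ be $\star^8$ followed, for $j=0,\dots,n_c-2$, by $$\star^8,\; V^4+2c_jV^3-V,\; 2V^4+2c_jV^3+V,\; 3V^4-2c_jV^3+(-1)^{b_j}V,\; 4V^4-2c_jV^3-(-1)^{b_j}V,\;\star^8 .$$ For every Intermediary instance and every integer $V\ge U$ with $V>n_rn_c\bigl(\max(1,\max_i d_i)\cdot\max(1,\max_i r_i)\cdot\max(1,\max_j c_j)\bigr)^2$, we have $|P|=\nu(n_r)$, $|Q|=\mu(n_c)$, and with $$L=\mathrm{DTW}(P,Q)-|n_r-n_c|\,(4V^5+10V^4-U)-4V\min(n_r-1,n_c-1)$$ the answer of the instance is $L$ if $L<U|n_r-n_c|+\sqrt U$, and $\infty$ otherwise. (If all three maxima are at least $1$, then $V=U$ is allowed.) 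-/

import Mathlib

/-! ## The machine model: a real RAM with unit-cost arithmetic

Programs are while-programs over named arrays of natural numbers and named arrays of real numbers
(each program mentions finitely many names), with indirect addressing: every array index is itself
a computed natural number. -/

namespace RealRAM

/-- The memory: `σ.nat a i` and `σ.real a i` are the `i`-th cells of the integer array and of the
real array with name `a`. -/
structure Mem where
  nat : ℕ → ℕ → ℕ
  real : ℕ → ℕ → ℝ

namespace Mem

/-- Overwrite one integer cell. -/
def setNat (σ : Mem) (a i v : ℕ) : Mem :=
  { σ with nat := Function.update σ.nat a (Function.update (σ.nat a) i v) }

/-- Overwrite one real cell. -/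
noncomputable def setReal (σ : Mem) (a i : ℕ) (v : ℝ) : Mem :=
  { σ with real := Function.update σ.real a (Function.update (σ.real a) i v) }

end Mem

/-- Integer expressions. Subtraction is truncated and division rounds down (`x / 0 = 0`). -/
inductive NatExpr where
  | const (k : ℕ)
  | read (a : ℕ) (i : NatExpr)
  | plus (e f : NatExpr)
  | minus (e f : NatExpr)
  | times (e f : NatExpr)
  | quot (e f : NatExpr)

/-- Real expressions. There is no rounding operation from reals to integers. -/
inductive RealExpr where
  | cast (e : NatExpr)
  | read (a : ℕ) (i : NatExpr)
  | plus (e f : RealExpr)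
  | minus (e f : RealExpr)
  | times (e f : RealExpr)
  | quot (e f : RealExpr)

/-- Tests. -/
inductive Test where
  | natLt (e f : NatExpr)
  | natEq (e f : NatExpr)
  | realLt (e f : RealExpr)
  | realEq (e f : RealExpr)

/-- Commands. -/
inductive Cmd where
  | skip
  | setNat (a : ℕ) (i : NatExpr) (e : NatExpr)
  | setReal (a : ℕ) (i : NatExpr) (e : RealExpr)
  | seq (c₁ c₂ : Cmd)
  | ite (t : Test) (c₁ c₂ : Cmd)
  | while (t : Test) (c : Cmd)

/-- The value of an integer expression. -/
def NatExpr.eval (σ : Mem) : NatExpr → ℕ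
  | .const k => k
  | .read a i => σ.nat a (i.eval σ)
  | .plus e f => e.eval σ + f.eval σ
  | .minus e f => e.eval σ - f.eval σ
  | .times e f => e.eval σ * f.eval σ
  | .quot e f => e.eval σ / f.eval σ

/-- The number of elementary operations in an integer expression. -/
def NatExpr.cost : NatExpr → ℕ
  | .const _ => 1
  | .read _ i => i.cost + 1
  | .plus e f => e.cost + f.cost + 1
  | .minus e f => e.cost + f.cost + 1
  | .times e f => e.cost + f.cost + 1
  | .quot e f => e.cost + f.cost + 1

/-- The value of a real expression. -/
noncomputable def RealExpr.eval (σ : Mem) : RealExpr → ℝ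
  | .cast e => (e.eval σ : ℝ)
  | .read a i => σ.real a (i.eval σ)
  | .plus e f => e.eval σ + f.eval σ
  | .minus e f => e.eval σ - f.eval σ
  | .times e f => e.eval σ * f.eval σ
  | .quot e f => e.eval σ / f.eval σ

/-- The number of elementary operations in a real expression. -/
def RealExpr.cost : RealExpr → ℕ
  | .cast e => e.cost + 1
  | .read _ i => i.cost + 1
  | .plus e f => e.cost + f.cost + 1
  | .minus e f => e.cost + f.cost + 1
  | .times e f => e.cost + f.cost + 1
  | .quot e f => e.cost + f.cost + 1

/-- The outcome of a test. -/
def Test.Holds (σ : Mem) : Test → Prop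
  | .natLt e f => e.eval σ < f.eval σ
  | .natEq e f => e.eval σ = f.eval σ
  | .realLt e f => e.eval σ < f.eval σ
  | .realEq e f => e.eval σ = f.eval σ

/-- The number of elementary operations in a test. -/
def Test.cost : Test → ℕ
  | .natLt e f => e.cost + f.cost + 1
  | .natEq e f => e.cost + f.cost + 1
  | .realLt e f => e.cost + f.cost + 1
  | .realEq e f => e.cost + f.cost + 1

/-- `Exec c σ t τ`: started in memory `σ`, the command `c` halts after exactly `t` elementary steps
in memory `τ`. -/
inductive Exec : Cmd → Mem → ℕ → Mem → Prop where
  | skip (σ : Mem) : Exec .skip σ 1 σ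
  | setNat (σ : Mem) (a : ℕ) (i e : NatExpr) :
      Exec (.setNat a i e) σ (i.cost + e.cost + 1) (σ.setNat a (i.eval σ) (e.eval σ))
  | setReal (σ : Mem) (a : ℕ) (i : NatExpr) (e : RealExpr) :
      Exec (.setReal a i e) σ (i.cost + e.cost + 1) (σ.setReal a (i.eval σ) (e.eval σ))
  | seq {c₁ c₂ : Cmd} {σ τ υ : Mem} {s t : ℕ} :
      Exec c₁ σ s τ → Exec c₂ τ t υ → Exec (.seq c₁ c₂) σ (s + t) υ
  | iteTrue {b : Test} {c₁ c₂ : Cmd} {σ τ : Mem} {t : ℕ} :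
      b.Holds σ → Exec c₁ σ t τ → Exec (.ite b c₁ c₂) σ (b.cost + t) τ
  | iteFalse {b : Test} {c₁ c₂ : Cmd} {σ τ : Mem} {t : ℕ} :
      ¬ b.Holds σ → Exec c₂ σ t τ → Exec (.ite b c₁ c₂) σ (b.cost + t) τ
  | whileTrue {b : Test} {c : Cmd} {σ τ υ : Mem} {s t : ℕ} :
      b.Holds σ → Exec c σ s τ → Exec (.while b c) τ t υ →
        Exec (.while b c) σ (b.cost + s + t) υ
  | whileFalse {b : Test} {c : Cmd} {σ : Mem} :
      ¬ b.Holds σ → Exec (.while b c) σ b.cost σ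

/-! ## Dynamic problems and data structures -/

/-- A dynamic problem with its input/output conventions. `load s` is the initial memory that holds
the input `s`; `pass s u σ` is the memory `σ` after the arguments of the update `u` were written
into the argument cells; `Answers s σ` says that the output cells of `σ` hold the right answer
to a query on the current data `s`. -/
structure DynamicProblem where
  State : Type
  Update : State → Type
  apply : (s : State) → Update s → State
  load : State → Mem
  pass : (s : State) → Update s → Mem → Mem
  Answers : State → Mem → Prop

/-- A data structure: one program each for preprocessing, updates and queries. -/
structure DataStructure where
  preprocess : Cmd
  update : Cmd
  query : Cmd

/-- `Reaches 𝓟 D s σ`: the memory `σ` arises from preprocessing some input followed by some finite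
sequence of updates and queries, and the current data are `s`. -/
inductive Reaches (𝓟 : DynamicProblem) (D : DataStructure) : 𝓟.State → Mem → Prop where
  | preprocess {s : 𝓟.State} {t : ℕ} {σ : Mem} :
      Exec D.preprocess (𝓟.load s) t σ → Reaches 𝓟 D s σ
  | update {s : 𝓟.State} {σ τ : Mem} {t : ℕ} (u : 𝓟.Update s) :
      Reaches 𝓟 D s σ → Exec D.update (𝓟.pass s u σ) t τ → Reaches 𝓟 D (𝓟.apply s u) τ
  | query {s : 𝓟.State} {σ τ : Mem} {t : ℕ} :
      Reaches 𝓟 D s σ → Exec D.query σ t τ → Reaches 𝓟 D s τ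

/-- The data structure `D` solves the dynamic problem `𝓟`: after preprocessing any input and after
any sequence of operations, each operation halts, within the stated (worst-case) number of steps,
and each query is answered correctly. -/
def Solves (𝓟 : DynamicProblem) (D : DataStructure) (TP TU TQ : 𝓟.State → ℕ) : Prop :=
  (∀ s, ∃ t σ, Exec D.preprocess (𝓟.load s) t σ ∧ t ≤ TP s) ∧
  (∀ s σ, Reaches 𝓟 D s σ → ∀ u, ∃ t τ, Exec D.update (𝓟.pass s u σ) t τ ∧ t ≤ TU s) ∧
  (∀ s σ, Reaches 𝓟 D s σ → ∃ t τ, Exec D.query σ t τ ∧ t ≤ TQ s ∧ 𝓟.Answers s τ)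

end RealRAM

/-! ## Grid paths -/

/-- A vertical, horizontal or diagonal step in matrix coordinates. -/
def GridStep (p q : ℕ × ℕ) : Prop :=
  q = (p.1 + 1, p.2) ∨ q = (p.1, p.2 + 1) ∨ q = (p.1 + 1, p.2 + 1)

/-- `π` is a directed grid path from `(0, 0)` to `(a, b)`. -/
def IsGridPath (a b : ℕ) (π : List (ℕ × ℕ)) : Prop :=
  π.head? = some (0, 0) ∧ π.getLast? = some (a, b) ∧ π.IsChain GridStep

/-! ## Dynamic time warping on the real line -/

/-- The cost of a traversal of the curves `P` and `Q` (indexed from `0`). -/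
noncomputable def traversalCost (P Q : List ℝ) (π : List (ℕ × ℕ)) : ℝ :=
  (π.map fun p => |P.getD p.1 0 - Q.getD p.2 0|).sum

/-- `v = DTW(P, Q)`, the minimum cost of a traversal, for nonempty curves `P` and `Q`. -/
def IsDTW (P Q : List ℝ) (v : ℝ) : Prop :=
  IsLeast {x | ∃ π, IsGridPath (P.length - 1) (Q.length - 1) π ∧ x = traversalCost P Q π} v

/-- Two nonempty curves in `ℝ`. -/
structure CurvePair where
  P : List ℝ
  Q : List ℝ
  P_ne : P ≠ []
  Q_ne : Q ≠ []

open RealRAM in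
/-- Dynamic DTW under substitutions in `Q`. Input: the lengths in cells `0, 1` of integer array `0`,
the curves in real arrays `0` and `1`. The update `(j, x)` substitutes the `j`-th vertex of `Q`
by `x`; arguments: `j` in cell `0` of integer array `1`, `x` in cell `0` of real array `2`.
Output: cell `0` of real array `3`. -/
noncomputable def dynamicDTW : DynamicProblem where
  State := CurvePair
  Update s := Fin s.Q.length × ℝ
  apply s u := { s with
    Q := s.Q.set u.1 u.2
    Q_ne := by simpa using s.Q_ne }
  load s :=
    { nat := fun a i => if a = 0 then [s.P.length, s.Q.length].getD i 0 else 0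
      real := fun a i =>
        if a = 0 then s.P.getD i 0 else if a = 1 then s.Q.getD i 0 else 0 }
  pass _ u σ := (σ.setNat 1 0 u.1).setReal 2 0 u.2
  Answers s σ := IsDTW s.P s.Q (σ.real 3 0)

/-! ## The problem Intermediary -/

/-- The maximum of a list of natural numbers. -/
def listMax (l : List ℕ) : ℕ := l.foldr max 0

/-- An instance of Intermediary (rows and columns are indexed from `0`): row identifiers `r`,
row weights `d`, column identifiers `c`, column Booleans `b`, and the parameter `U`. -/
structure Intermediary where
  r : List ℕ
  d : List ℕ
  c : List ℕ
  b : List Bool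
  U : ℕ
  r_ne : r ≠ []
  c_ne : c ≠ []
  d_length : d.length = r.length
  b_length : b.length = c.length
  U_gt : r.length * c.length * (listMax d * listMax r * listMax c) ^ 2 < U

namespace Intermediary

/-- The number of rows. -/
def nr (I : Intermediary) : ℕ := I.r.length

/-- The number of columns. -/
def nc (I : Intermediary) : ℕ := I.c.length

/-- `| n_r - n_c |` -/
def gap (I : Intermediary) : ℕ := ((I.nr : ℤ) - I.nc).natAbs

/-- The weight of the grid edge from `p` to `q`. -/
noncomputable def weight (I : Intermediary) (p q : ℕ × ℕ) : ℝ :=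
  if q = (p.1 + 1, p.2 + 1) then
    if I.r.getD p.1 0 = I.c.getD p.2 0 then (I.d.getD p.1 0 : ℝ) * ((I.b.getD p.2 false).toNat : ℝ)
    else √(I.U : ℝ)
  else (I.U : ℝ)

/-- The length of a path: the sum of its edge weights. -/
noncomputable def pathLength (I : Intermediary) : List (ℕ × ℕ) → ℝ
  | [] => 0
  | [_] => 0
  | p :: q :: π => I.weight p q + pathLength I (q :: π)

/-- `L` is the length of a shortest path from `(0, 0)` to `(n_r - 1, n_c - 1)`. -/
def IsShortest (I : Intermediary) (L : ℝ) : Prop :=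
  IsLeast {x | ∃ π, IsGridPath (I.nr - 1) (I.nc - 1) π ∧ x = I.pathLength π} L

open Classical in
/-- A length is reported as `∞` from `U * |n_r - n_c| + √U` on. -/
noncomputable def report (I : Intermediary) (L : ℝ) : WithTop ℝ :=
  if L < (I.U : ℝ) * I.gap + √(I.U : ℝ) then (L : WithTop ℝ) else ⊤

/-- `o` is the answer to a query. -/
def IsAnswer (I : Intermediary) (o : WithTop ℝ) : Prop :=
  ∃ L, I.IsShortest L ∧ o = I.report L

/-- `I` after the update that sets `b_j := x`. -/
def setB (I : Intermediary) (j : ℕ) (x : Bool) : Intermediary :=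
  { I with
    b := I.b.set j x
    b_length := by simpa using I.b_length }

open RealRAM in
/-- Intermediary as a dynamic problem. Input: `n_r, n_c, U` in cells `0, 1, 2` of integer array
`0`, and `r, d, c, b` in integer arrays `1, 2, 3, 4`. Update `(j, x)`: arguments `j, x` in cells
`0, 1` of integer array `5`. Output: cell `0` of integer array `6` is `1` if the answer is `∞`;
otherwise it is `0` and the answer is in cell `0` of real array `0`. -/
noncomputable def problem : DynamicProblem where
  State := Intermediary
  Update I := Fin I.nc × Bool
  apply I u := I.setB u.1 u.2
  load I :=
    { nat := fun a i =>
        if a = 0 then [I.nr, I.nc, I.U].getD i 0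
        else if a = 1 then I.r.getD i 0
        else if a = 2 then I.d.getD i 0
        else if a = 3 then I.c.getD i 0
        else if a = 4 then (I.b.getD i false).toNat
        else 0
      real := fun _ _ => 0 }
  pass _ u σ := (σ.setNat 5 0 u.1).setNat 5 1 u.2.toNat
  Answers I σ :=
    (σ.nat 6 0 = 1 ∧ I.IsAnswer ⊤) ∨ (σ.nat 6 0 = 0 ∧ I.IsAnswer (σ.real 0 0 : WithTop ℝ))

/-! ## The gadget curves, with parameter `V` -/

/-- Eight consecutive visits of the point `-V^5`. -/
noncomputable def stars (V : ℝ) : List ℝ := List.replicate 8 (-V ^ 5)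

/-- The gadget of a row with identifier `r` and weight `d`. -/
noncomputable def rowGadget (V r d : ℝ) : List ℝ :=
  stars V ++
    [V ^ 4 + 2 * r * V ^ 3 + d / 4,
     2 * V ^ 4 + 2 * r * V ^ 3 - d / 4,
     3 * V ^ 4 - 2 * r * V ^ 3 + d / 4,
     4 * V ^ 4 - 2 * r * V ^ 3 - d / 4] ++
  stars V

/-- The gadget of a column with identifier `c` and Boolean `b`. -/
noncomputable def colGadget (V c : ℝ) (b : Bool) : List ℝ :=
  stars V ++
    [V ^ 4 + 2 * c * V ^ 3 - V,
     2 * V ^ 4 + 2 * c * V ^ 3 + V,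
     3 * V ^ 4 - 2 * c * V ^ 3 + (-1) ^ b.toNat * V,
     4 * V ^ 4 - 2 * c * V ^ 3 - (-1) ^ b.toNat * V] ++
  stars V

/-- The curve `P`: stars, followed by the gadgets of all rows but the last (no diagonal edge
starts in the last row). -/
noncomputable def curveP (I : Intermediary) (V : ℝ) : List ℝ :=
  stars V ++ (List.range (I.nr - 1)).flatMap fun i => rowGadget V (I.r.getD i 0) (I.d.getD i 0)

/-- The curve `Q`: stars, followed by the gadgets of all columns but the last. -/
noncomputable def curveQ (I : Intermediary) (V : ℝ) : List ℝ :=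
  stars V ++ (List.range (I.nc - 1)).flatMap fun j => colGadget V (I.c.getD j 0) (I.b.getD j false)

/-- The offset `|n_r - n_c| (4 V^5 + 10 V^4 - U) + 4 V min(n_r - 1, n_c - 1)`. -/
noncomputable def offset (I : Intermediary) (V : ℝ) : ℝ :=
  (I.gap : ℝ) * (4 * V ^ 5 + 10 * V ^ 4 - I.U) + 4 * V * (min (I.nr - 1) (I.nc - 1) : ℕ)

end Intermediary

/-! ## Grid paths -/

/-! Each curve is a row of blocks of length 20, sixteen visits of the star `-V^5` followed by four
nonnegative core vertices, with eight more stars at the end. The grid vertex `(i, j)` corresponds to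
the index pair `(20 i + 7, 20 j + 7)`, where both curves are on a star.

Upper bound. Crossing a block while the other curve waits on a star costs `S = 4 V^5 + 10 V^4`,
whatever the block. Crossing two blocks in parallel costs `4 V + d b` if their identifiers agree:
aligned vertices are at distance `V + d / 4` or `V - d / 4`, and the Boolean decides the sign for
the last two. A grid path below the threshold has the maximal number of diagonal edges, all between
equal identifiers, and so becomes a traversal whose cost is its length plus `offset`
(`exists_traversal_of_path`).

Lower bound. Regard a traversal as a monotone correspondence and let the degree of a block be the
number of blocks of the other curve whose core meets its own. A block of degree 0 sends its core to
stars and pays `S`; each partner beyond the first forces sixteen stars onto the core. So degree `n`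
costs at least `S |1 - n|`, with a surplus `slack` if `n` is at least 2. Both degree sequences sum
to the number of links, hence the total is at least `S |n_r - n_c|`. Below the threshold less than
`slack` is left over; this forces degrees at most 1 and a matching of maximal size
(`Correspondence.exists_matching`). Misaligned cores or different identifiers cost at least `V^3 - 2
V`, again at least `slack`, so matched blocks are aligned and agree. The matching is then followed
by a grid path (`exists_path_of_matching`). The two conditional inequalities make the reports equal
(`exists_isDTW_curves`).

Data structure. The given programs run with array names shifted by 8, out of reach of the other
arrays (`Exec.shift`). The parameter depends on `U`, `r`, `d`, `c` only, so an update changes two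
vertices of `Q`. The comparison with `√U` is made by squaring. Every run takes a step, so constant
overhead becomes a constant factor (`solves_reduction`). -/

theorem isGridPath_singleton : IsGridPath 0 0 [(0, 0)] := by simp [IsGridPath]

theorem IsGridPath.concat {a b a' b' : ℕ} {π : List (ℕ × ℕ)} (h : IsGridPath a b π)
    (hs : GridStep (a, b) (a', b')) : IsGridPath a' b' (π ++ [(a', b')]) := by
  obtain ⟨h1, h2, h3⟩ := h
  refine ⟨?_, by simp, ?_⟩
  · rw [List.head?_append, h1]; rfl
  · rw [List.isChain_append]
    refine ⟨h3, by simp, ?_⟩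
    simp [h2, hs]

/-- Peels off the last step, so that the end point of the remaining prefix is again an index of the
motive. -/
theorem IsGridPath.induction {motive : ℕ → ℕ → List (ℕ × ℕ) → Prop}
    (single : motive 0 0 [(0, 0)])
    (concat : ∀ a b a' b' π, IsGridPath a b π → GridStep (a, b) (a', b') → motive a b π →
      motive a' b' (π ++ [(a', b')]))
    {a b : ℕ} {π : List (ℕ × ℕ)} (h : IsGridPath a b π) : motive a b π := by
  induction π using List.reverseRecOn generalizing a b with
  | nil => simp [IsGridPath] at h
  | append_singleton π x ih =>
    obtain ⟨h1, h2, h3⟩ := h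
    simp only [List.getLast?_append, List.getLast?_singleton, Option.some_or,
      Option.some.injEq] at h2
    subst h2
    rcases hl : π.getLast? with _ | ⟨a₁, b₁⟩
    · rw [List.getLast?_eq_none_iff] at hl
      subst hl
      simp at h1
      obtain ⟨rfl, rfl⟩ := h1
      exact single
    · rw [List.isChain_append] at h3
      obtain ⟨h3, -, h4⟩ := h3
      have hne : π ≠ [] := by rintro rfl; simp at hl
      have h5 : IsGridPath a₁ b₁ π := by
        refine ⟨?_, hl, h3⟩
        rw [List.head?_append] at h1
        cases π with
        | nil => exact absurd rfl hne
        | cons y l => simpa using h1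
      exact concat a₁ b₁ a b π h5 (h4 _ hl _ (by simp)) (ih h5)

/-- A nontrivial path extends, by one step, a path to a point of smaller coordinate sum. -/
theorem finite_isGridPath (a b : ℕ) : {π | IsGridPath a b π}.Finite := by
  suffices H : ∀ n a b, a + b = n → {π | IsGridPath a b π}.Finite from H _ a b rfl
  intro n
  induction n using Nat.strong_induction_on with
  | _ n ih =>
    intro a b hab
    have hfin : (⋃ p ∈ ((Finset.range (a + 1) ×ˢ Finset.range (b + 1)).filter
        fun p : ℕ × ℕ => p.1 + p.2 < n : Finset (ℕ × ℕ)), {π | IsGridPath p.1 p.2 π}).Finite := by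
      refine Set.Finite.biUnion (Finset.finite_toSet _) ?_
      intro p hp
      have hp' : p.1 + p.2 < n := by
        have := Finset.mem_coe.1 hp
        simp only [Finset.mem_filter] at this
        exact this.2
      exact ih _ hp' _ _ rfl
    refine ((Set.finite_singleton [((0 : ℕ), (0 : ℕ))]).union
      (hfin.image fun π => π ++ [(a, b)])).subset ?_
    intro π hπ
    have key : ∀ {a b : ℕ} {π : List (ℕ × ℕ)}, IsGridPath a b π → π = [(0, 0)] ∨
        ∃ a₁ b₁ π', IsGridPath a₁ b₁ π' ∧ GridStep (a₁, b₁) (a, b) ∧ π = π' ++ [(a, b)] := by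
      intro a b π h
      refine h.induction (motive := fun a b π => π = [(0, 0)] ∨
        ∃ a₁ b₁ π', IsGridPath a₁ b₁ π' ∧ GridStep (a₁, b₁) (a, b) ∧ π = π' ++ [(a, b)])
        (Or.inl rfl) ?_
      intro a b a' b' π h hs _
      exact Or.inr ⟨a, b, π, h, hs, rfl⟩
    rcases key hπ with h | ⟨a₁, b₁, π', h1, h2, h3⟩
    · exact Or.inl h
    · refine Or.inr ⟨π', ?_, h3.symm⟩
      simp only [Set.mem_iUnion]
      refine ⟨(a₁, b₁), ?_, h1⟩
      simp only [GridStep, Prod.mk.injEq] at h2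
      simp only [Finset.mem_filter, Finset.mem_product, Finset.mem_range]
      omega

theorem exists_isGridPath (a b : ℕ) : ∃ π, IsGridPath a b π := by
  induction a with
  | zero =>
    induction b with
    | zero => exact ⟨_, isGridPath_singleton⟩
    | succ b ih =>
      obtain ⟨π, h⟩ := ih
      exact ⟨_, h.concat (Or.inr (Or.inl rfl))⟩
  | succ a ih =>
    obtain ⟨π, h⟩ := ih
    exact ⟨_, h.concat (Or.inl rfl)⟩

theorem exists_isLeast_gridPath (a b : ℕ) (f : List (ℕ × ℕ) → ℝ) :
    ∃ v, IsLeast {x | ∃ π, IsGridPath a b π ∧ x = f π} v := by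
  have h : {x | ∃ π, IsGridPath a b π ∧ x = f π} = f '' {π | IsGridPath a b π} := by
    ext x; simp [eq_comm]
  rw [h]
  have hf := (finite_isGridPath a b).image f
  have hn : (f '' {π | IsGridPath a b π}).Nonempty := by
    obtain ⟨π, hπ⟩ := exists_isGridPath a b
    exact ⟨_, π, hπ, rfl⟩
  exact ⟨_, hn.csInf_mem hf, fun x hx => csInf_le hf.bddBelow hx⟩

/-! ### Grid paths as monotone correspondences -/

/-- A monotone set of index pairs that covers the index ranges `0..a` and `0..b`. -/
structure Correspondence (a b : ℕ) (T : Finset (ℕ × ℕ)) : Prop where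
  le : ∀ t ∈ T, t.1 ≤ a ∧ t.2 ≤ b
  left : ∀ x ≤ a, ∃ y, (x, y) ∈ T
  right : ∀ y ≤ b, ∃ x, (x, y) ∈ T
  mono : ∀ s ∈ T, ∀ t ∈ T, s.1 < t.1 → s.2 ≤ t.2

theorem Correspondence.mono' {a b : ℕ} {T : Finset (ℕ × ℕ)} (h : Correspondence a b T) :
    ∀ s ∈ T, ∀ t ∈ T, s.2 < t.2 → s.1 ≤ t.1 := by
  intro s hs t ht hst
  by_contra! hc
  exact absurd (h.mono t ht s hs hc) (by omega)

/-- The symmetry that makes every bound for blocks of the first curve available for the second. -/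
theorem Correspondence.swap {a b : ℕ} {T : Finset (ℕ × ℕ)} (h : Correspondence a b T) :
    Correspondence b a (T.map (Equiv.prodComm ℕ ℕ).toEmbedding) := by
  have hmem : ∀ x y, (x, y) ∈ T.map (Equiv.prodComm ℕ ℕ).toEmbedding ↔ (y, x) ∈ T := by
    intro x y; simp
  refine ⟨?_, ?_, ?_, ?_⟩
  · rintro ⟨x, y⟩ ht
    rw [hmem] at ht
    exact (h.le _ ht).symm
  · intro x hx
    obtain ⟨y, hy⟩ := h.right x hx
    exact ⟨y, (hmem _ _).2 hy⟩
  · intro x hx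
    obtain ⟨y, hy⟩ := h.left x hx
    exact ⟨y, (hmem _ _).2 hy⟩
  · rintro ⟨x, y⟩ hs ⟨x', y'⟩ ht hst
    rw [hmem] at hs ht
    exact h.mono' _ hs _ ht hst

/-- A path never returns to a pair, so passing to its set of pairs preserves the cost. -/
theorem IsGridPath.correspondence {a b : ℕ} {π : List (ℕ × ℕ)} (h : IsGridPath a b π) :
    Correspondence a b π.toFinset ∧ π.Nodup := by
  refine h.induction (motive := fun a b π => Correspondence a b π.toFinset ∧ π.Nodup) ?_ ?_
  · refine ⟨⟨?_, ?_, ?_, ?_⟩, by simp⟩ <;> simp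
  · rintro a b a' b' π - hs ⟨hc, hn⟩
    simp only [GridStep, Prod.mk.injEq] at hs
    have hle := hc.le
    have hl := hc.left
    have hr := hc.right
    have hm := hc.mono
    simp only [List.mem_toFinset] at hle hl hr hm
    refine ⟨⟨?_, ?_, ?_, ?_⟩, ?_⟩
    · intro t ht
      simp only [List.toFinset_append, Finset.mem_union, List.mem_toFinset,
        List.mem_singleton] at ht
      rcases ht with ht | rfl
      · have := hle t ht; omega
      · simp
    · intro x hx
      by_cases hxa : x ≤ a
      · obtain ⟨y, hy⟩ := hl x hxa
        exact ⟨y, by simp [hy]⟩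
      · have : x = a' := by omega
        exact ⟨b', by simp [this]⟩
    · intro x hx
      by_cases hxa : x ≤ b
      · obtain ⟨y, hy⟩ := hr x hxa
        exact ⟨y, by simp [hy]⟩
      · have : x = b' := by omega
        exact ⟨a', by simp [this]⟩
    · intro s hs' t ht hst
      simp only [List.toFinset_append, Finset.mem_union, List.mem_toFinset,
        List.mem_singleton] at hs' ht
      rcases hs' with hs' | rfl <;> rcases ht with ht | rfl
      · exact hm s hs' t ht hst
      · have := hle s hs'; simp only at *; omega
      · have := hle t ht; simp only at *; omega
      · omega
    · rw [List.nodup_append]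
      refine ⟨hn, by simp, ?_⟩
      intro t ht u hu
      simp only [List.mem_singleton] at hu
      rintro rfl
      have := hle t ht
      subst hu
      simp only at this
      omega

theorem IsGridPath.traversalCost_eq {a b : ℕ} {π : List (ℕ × ℕ)} (h : IsGridPath a b π)
    (P Q : List ℝ) :
    traversalCost P Q π = ∑ t ∈ π.toFinset, |P.getD t.1 0 - Q.getD t.2 0| := by
  rw [traversalCost, List.sum_toFinset _ h.correspondence.2]

theorem traversalCost_concat (P Q : List ℝ) (π : List (ℕ × ℕ)) (x y : ℕ) :
    traversalCost P Q (π ++ [(x, y)]) = traversalCost P Q π + |P.getD x 0 - Q.getD y 0| := by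
  simp [traversalCost]

namespace Intermediary

theorem pathLength_concat (I : Intermediary) {a b : ℕ} {π : List (ℕ × ℕ)} (h : IsGridPath a b π)
    (q : ℕ × ℕ) : I.pathLength (π ++ [q]) = I.pathLength π + I.weight (a, b) q := by
  have key : ∀ (π : List (ℕ × ℕ)) (p : ℕ × ℕ), π.getLast? = some p →
      I.pathLength (π ++ [q]) = I.pathLength π + I.weight p q := by
    intro π
    induction π with
    | nil => simp
    | cons x l ih =>
      intro p hp
      cases l with
      | nil =>
        simp at hp
        subst hp
        simp [pathLength]
      | cons y l =>
        have := ih p (by simpa using hp)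
        simp only [List.cons_append, pathLength] at this ⊢
        rw [this]; ring
  exact key π _ h.2.1

end Intermediary

/-! ## Lower bound for block curves -/

/-- The `x`-th vertex of a curve of blocks of length `20`, each made of sixteen visits of the
point `-Z` and four further vertices. -/
def blockVal (Z : ℝ) (f : ℕ → ℕ → ℝ) (x : ℕ) : ℝ :=
  if x % 20 < 16 then -Z else f (x / 20) (x % 20 - 16)

theorem blockVal_star {Z : ℝ} {f : ℕ → ℕ → ℝ} {x : ℕ} (h : x % 20 < 16) :
    blockVal Z f x = -Z := if_pos h

theorem blockVal_core {Z : ℝ} {f : ℕ → ℕ → ℝ} {x : ℕ} (h : 16 ≤ x % 20) :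
    blockVal Z f x = f (x / 20) (x % 20 - 16) := if_neg (by omega)

theorem blockVal_core' {Z : ℝ} {f : ℕ → ℕ → ℝ} {i k : ℕ} (hk : k < 4) :
    blockVal Z f (20 * i + 16 + k) = f i k := by
  rw [blockVal_core (by omega)]
  congr 1 <;> omega

/-- Lower bounds on costs come from exhibiting distinct pairs; the others are dropped by
nonnegativity. -/
theorem sum_comp_le_sum_of_injOn {ι α : Type*} {s : Finset ι} {t : Finset α}
    (φ : ι → α) (w : α → ℝ) (hw : ∀ x ∈ t, 0 ≤ w x) (hφ : Set.InjOn φ s) (hm : ∀ i ∈ s, φ i ∈ t) :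
    ∑ i ∈ s, w (φ i) ≤ ∑ x ∈ t, w x := by
  classical
  rw [← Finset.sum_image hφ]
  refine Finset.sum_le_sum_of_subset_of_nonneg ?_ fun x hx _ => hw x hx
  intro x hx
  obtain ⟨i, hi, rfl⟩ := Finset.mem_image.1 hx
  exact hm i hi

/-- Some pair of `T` joins the core of block `i` to the core of block `j`. -/
def Linked (T : Finset (ℕ × ℕ)) (i j : ℕ) : Prop :=
  ∃ t ∈ T, 16 ≤ t.1 % 20 ∧ 16 ≤ t.2 % 20 ∧ t.1 / 20 = i ∧ t.2 / 20 = j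

/-- The pairs of `T` that join the core of block `i` to a star. -/
def starPairs (T : Finset (ℕ × ℕ)) (i : ℕ) : Finset (ℕ × ℕ) :=
  T.filter fun t => 16 ≤ t.1 % 20 ∧ t.1 / 20 = i ∧ t.2 % 20 < 16

/-- The cost of a pair of indices for two block curves. -/
def pairCost (Z : ℝ) (f g : ℕ → ℕ → ℝ) (t : ℕ × ℕ) : ℝ :=
  |blockVal Z f t.1 - blockVal Z g t.2|

theorem pairCost_nonneg (Z : ℝ) (f g : ℕ → ℕ → ℝ) (t : ℕ × ℕ) : 0 ≤ pairCost Z f g t :=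
  abs_nonneg _

theorem pairCost_swap (Z : ℝ) (f g : ℕ → ℕ → ℝ) (t : ℕ × ℕ) :
    pairCost Z g f t.swap = pairCost Z f g t := abs_sub_comm _ _

/-! ### The cost of pairs that join a core to a star -/

section StarBounds

variable {N M : ℕ} {T : Finset (ℕ × ℕ)} {Z : ℝ} {f g : ℕ → ℕ → ℝ}

/-- The last index `20 * N + 7` is a star, so a core index lies in one of the `N` complete blocks.
-/
theorem Correspondence.lt_of_core (hT : Correspondence (20 * N + 7) (20 * M + 7) T) {t : ℕ × ℕ}
    (ht : t ∈ T) : (16 ≤ t.1 % 20 → t.1 / 20 < N) ∧ (16 ≤ t.2 % 20 → t.2 / 20 < M) := by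
  have := hT.le t ht
  constructor <;> intro h <;> omega

theorem pairCost_star (hZ : 0 ≤ Z) (hf : ∀ i < N, ∀ k < 4, 0 ≤ f i k)
    (hT : Correspondence (20 * N + 7) (20 * M + 7) T) {i : ℕ} {t : ℕ × ℕ}
    (ht : t ∈ starPairs T i) :
    pairCost Z f g t = f i (t.1 % 20 - 16) + Z ∧ Z ≤ pairCost Z f g t := by
  rw [starPairs, Finset.mem_filter] at ht
  obtain ⟨h1, h2, rfl, h4⟩ := ht
  have hi := (hT.lt_of_core h1).1 h2
  have h0 := hf _ hi (t.1 % 20 - 16) (by omega)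
  have : pairCost Z f g t = f (t.1 / 20) (t.1 % 20 - 16) + Z := by
    rw [pairCost, blockVal_core h2, blockVal_star h4, sub_neg_eq_add, abs_of_nonneg]
    linarith
  exact ⟨this, by linarith⟩

/-- Without a link, each of the four core vertices has only stars to meet. -/
theorem sum_starPairs_of_not_linked (hZ : 0 ≤ Z) (hf : ∀ i < N, ∀ k < 4, 0 ≤ f i k)
    (hT : Correspondence (20 * N + 7) (20 * M + 7) T) {i : ℕ} (hi : i < N)
    (hn : ∀ j < M, ¬ Linked T i j) :
    ∑ k ∈ Finset.range 4, f i k + 4 * Z ≤ ∑ t ∈ starPairs T i, pairCost Z f g t := by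
  have h1 : ∀ k, ∃ y, k < 4 → (20 * i + 16 + k, y) ∈ T := by
    intro k
    by_cases hk : k < 4
    · obtain ⟨y, hy⟩ := hT.left (20 * i + 16 + k) (by omega)
      exact ⟨y, fun _ => hy⟩
    · exact ⟨0, fun h => absurd h hk⟩
  choose y hy using h1
  have h2 : ∀ k ∈ Finset.range 4, (20 * i + 16 + k, y k) ∈ starPairs T i := by
    intro k hk
    have hk := Finset.mem_range.1 hk
    have hy := hy k hk
    rw [starPairs, Finset.mem_filter]
    refine ⟨hy, by simp only; omega, by simp only; omega, ?_⟩
    by_contra! hc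
    exact hn (y k / 20) ((hT.lt_of_core hy).2 hc)
      ⟨_, hy, by simp only; omega, hc, by simp only; omega, rfl⟩
  have h3 := sum_comp_le_sum_of_injOn (s := Finset.range 4) (t := starPairs T i)
    (fun k => (20 * i + 16 + k, y k)) (pairCost Z f g) (fun _ _ => pairCost_nonneg _ _ _ _)
    (by intro a _ b _ h; simp only [Prod.mk.injEq] at h; omega) h2
  refine le_trans (le_of_eq ?_) h3
  have h4 : ∀ k ∈ Finset.range 4, pairCost Z f g (20 * i + 16 + k, y k) = f i k + Z := by
    intro k hk
    rw [(pairCost_star (f := f) (g := g) hZ hf hT (h2 k hk)).1]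
    have hk := Finset.mem_range.1 hk
    congr 2
    simp only; omega
  rw [Finset.sum_congr rfl h4, Finset.sum_add_distrib]
  simp

open Classical in
-- Let `j₀` be the least partner. For any other partner `j`, the sixteen stars before core `j` lie
-- between two cores that both meet core `i`, so monotonicity pairs them all with core `i`.
-- Different partners use different stars.
theorem sum_starPairs_of_linked (hZ : 0 ≤ Z) (hf : ∀ i < N, ∀ k < 4, 0 ≤ f i k)
    (hT : Correspondence (20 * N + 7) (20 * M + 7) T) {i : ℕ}
    (hn : 1 ≤ ((Finset.range M).filter (Linked T i)).card) :
    16 * Z * (((Finset.range M).filter (Linked T i)).card - 1 : ℝ) ≤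
      ∑ t ∈ starPairs T i, pairCost Z f g t := by
  set J := (Finset.range M).filter (Linked T i) with hJ
  have hJne : J.Nonempty := Finset.card_pos.1 hn
  set j₀ := J.min' hJne with hj₀
  have hj₀J : j₀ ∈ J := Finset.min'_mem _ _
  have hlink : ∀ j ∈ J, Linked T i j := fun j hj => (Finset.mem_filter.1 hj).2
  have hlt : ∀ j ∈ J.erase j₀, j₀ < j := by
    intro j hj
    have h1 := Finset.min'_le J j (Finset.mem_of_mem_erase hj)
    have h2 := Finset.ne_of_mem_erase hj
    omega
  have h1 : ∀ p : ℕ × ℕ, ∃ x, p ∈ (J.erase j₀) ×ˢ Finset.range 16 →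
      (x, 20 * p.1 + p.2) ∈ starPairs T i := by
    rintro ⟨j, s⟩
    by_cases hp : (j, s) ∈ (J.erase j₀) ×ˢ Finset.range 16
    · obtain ⟨hj, hs⟩ := Finset.mem_product.1 hp
      have hs := Finset.mem_range.1 hs
      have hjj := hlt j hj
      obtain ⟨t, ht, a1, a2, a3, a4⟩ := hlink j₀ hj₀J
      obtain ⟨u, hu, b1, b2, b3, b4⟩ := hlink j (Finset.mem_of_mem_erase hj)
      have hule := (hT.le u hu).2
      simp only at hj hs hjj
      -- Star `s` of block `j` comes after core `j₀` and before core `j`; `c1` and `c2` trap its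
      -- partner `x` between two indices of core `i`.
      obtain ⟨x, hx⟩ := hT.right (20 * j + s) (by omega)
      have c1 := hT.mono' t ht _ hx (by simp only; omega)
      have c2 := hT.mono' _ hx u hu (by simp only; omega)
      simp only at c1 c2
      refine ⟨x, fun _ => ?_⟩
      rw [starPairs, Finset.mem_filter]
      refine ⟨hx, ?_, ?_, ?_⟩ <;> simp only <;> omega
    · exact ⟨0, fun h => absurd h hp⟩
  choose x hx using h1
  have h3 := sum_comp_le_sum_of_injOn (s := (J.erase j₀) ×ˢ Finset.range 16) (t := starPairs T i)
    (fun p => (x p, 20 * p.1 + p.2)) (pairCost Z f g) (fun _ _ => pairCost_nonneg _ _ _ _)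
    (by
      rintro ⟨a, b⟩ h ⟨a', b'⟩ h' hab
      simp only [Finset.coe_product, Set.mem_prod, Finset.mem_coe, Finset.mem_range] at h h'
      simp only [Prod.mk.injEq] at hab ⊢
      omega) hx
  refine le_trans ?_ h3
  have h4 := Finset.card_nsmul_le_sum ((J.erase j₀) ×ˢ Finset.range 16)
    (fun p => pairCost Z f g (x p, 20 * p.1 + p.2)) Z
    (fun p hp => (pairCost_star (f := f) (g := g) hZ hf hT (hx p hp)).2)
  refine le_trans (le_of_eq ?_) h4
  rw [Finset.card_product, Finset.card_erase_of_mem hj₀J, Finset.card_range, nsmul_eq_mul]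
  push_cast [Nat.cast_sub hn]
  ring

theorem le_sum_starPairs_of_mem (hZ : 0 ≤ Z) (hf : ∀ i < N, ∀ k < 4, 0 ≤ f i k)
    (hT : Correspondence (20 * N + 7) (20 * M + 7) T) {i : ℕ} {t : ℕ × ℕ}
    (ht : t ∈ starPairs T i) : Z ≤ ∑ t ∈ starPairs T i, pairCost Z f g t :=
  (pairCost_star (f := f) (g := g) hZ hf hT ht).2.trans
    (Finset.single_le_sum (f := pairCost Z f g) (fun _ _ => pairCost_nonneg Z f g _) ht)

open Classical in
/-- The cost of the star pairs of a block of degree `n` is at least `S |1 - n|`, with some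
extra cost if `n` is at least `2`. -/
theorem sum_starPairs_bound {s₀ σ : ℝ} (hZ : 0 ≤ Z) (hf : ∀ i < N, ∀ k < 4, 0 ≤ f i k)
    (hs : ∀ i < N, ∑ k ∈ Finset.range 4, f i k = s₀) (h16 : 4 * Z + s₀ + σ ≤ 16 * Z)
    (hσ : 0 ≤ σ)
    (hT : Correspondence (20 * N + 7) (20 * M + 7) T) {i : ℕ} (hi : i < N) {n : ℕ}
    (hn : n = ((Finset.range M).filter (Linked T i)).card) :
    (4 * Z + s₀) * |1 - (n : ℤ)| ≤ ∑ t ∈ starPairs T i, pairCost Z f g t ∧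
    (2 ≤ n → (4 * Z + s₀) * |1 - (n : ℤ)| + σ ≤ ∑ t ∈ starPairs T i, pairCost Z f g t) := by
  rcases Nat.eq_zero_or_pos n with h0 | h1
  · have hc : ∀ j < M, ¬ Linked T i j := by
      intro j hj hl
      have : j ∈ (Finset.range M).filter (Linked T i) :=
        Finset.mem_filter.2 ⟨Finset.mem_range.2 hj, hl⟩
      rw [Finset.card_eq_zero.1 (hn.symm.trans h0)] at this
      simp at this
    have := sum_starPairs_of_not_linked (g := g) hZ hf hT hi hc
    rw [hs i hi] at this
    refine ⟨?_, fun h => by omega⟩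
    subst h0
    norm_num
    linarith
  · have h2 := sum_starPairs_of_linked (f := f) (g := g) hZ hf hT (hn ▸ h1)
    rw [← hn] at h2
    have h3 : ((|1 - (n : ℤ)| : ℤ) : ℝ) = n - 1 := by
      rw [abs_of_nonpos (by omega)]; push_cast; ring
    rw [h3]
    have h4 : (1 : ℝ) ≤ n := by exact_mod_cast h1
    -- Each partner beyond the first costs `16 Z`, which exceeds `4 Z + s₀` by at least `σ`.
    refine ⟨?_, fun h => ?_⟩
    · nlinarith
    · have h5 : (2 : ℝ) ≤ n := by exact_mod_cast h
      nlinarith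

end StarBounds

/-! ### From degrees of blocks to a matching -/

open Classical in
/-- A correspondence of two block curves whose cost is within the budget contains a monotone
matching of the blocks. -/
theorem Correspondence.exists_matching {N M : ℕ} {T : Finset (ℕ × ℕ)} {Z s₀ σ : ℝ}
    {f g : ℕ → ℕ → ℝ} (hT : Correspondence (20 * N + 7) (20 * M + 7) T)
    (hf : ∀ i < N, ∀ k < 4, 0 ≤ f i k) (hg : ∀ j < M, ∀ k < 4, 0 ≤ g j k)
    (hfs : ∀ i < N, ∑ k ∈ Finset.range 4, f i k = s₀)
    (hgs : ∀ j < M, ∑ k ∈ Finset.range 4, g j k = s₀)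
    (hσ : 0 ≤ σ) (hs₀ : 0 ≤ s₀) (hσZ : σ ≤ Z) (h16 : 4 * Z + s₀ + σ ≤ 16 * Z)
    (hcross : ∀ i < N, ∀ j < M, ∀ k < 4, ∀ l < 4, k ≠ l → σ ≤ |f i k - g j l|)
    (hcost : ∑ t ∈ T, pairCost Z f g t < (4 * Z + s₀) * ((N : ℤ) - M).natAbs + σ) :
    ∃ E : Finset (ℕ × ℕ), (∀ p ∈ E, p.1 < N ∧ p.2 < M) ∧
      (∀ p ∈ E, ∀ q ∈ E, p.1 < q.1 ↔ p.2 < q.2) ∧ E.card = min N M ∧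
      (4 * Z + s₀) * ((N : ℤ) - M).natAbs +
          ∑ p ∈ E, ∑ k ∈ Finset.range 4, |f p.1 k - g p.2 k| ≤ ∑ t ∈ T, pairCost Z f g t := by
  generalize hG : ((N : ℤ) - M).natAbs = G at hcost ⊢
  set w := pairCost Z f g with hw
  have hw0 : ∀ t, 0 ≤ w t := pairCost_nonneg Z f g
  have hZ : 0 ≤ Z := hσ.trans hσZ
  set S := 4 * Z + s₀ with hS
  have hσS : σ ≤ S := by linarith
  set dR : ℕ → ℕ := fun i => ((Finset.range M).filter (Linked T i)).card with hdR
  set dC : ℕ → ℕ := fun j => ((Finset.range N).filter fun i => Linked T i j).card with hdC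
  -- `R i` collects every pair with first index in core `i`; `Cc j` takes only pairs of core `j`
  -- with a star. No pair is counted twice, and core-to-core costs are charged to the rows.
  set R : ℕ → ℝ := fun i => ∑ t ∈ (T.filter fun t => 16 ≤ t.1 % 20).filter (fun t => t.1 / 20 = i),
    w t with hR
  set T' := T.map (Equiv.prodComm ℕ ℕ).toEmbedding with hT'
  have hT's := hT.swap
  have hlink : ∀ i j, Linked T' j i ↔ Linked T i j := by
    intro i j
    constructor
    · rintro ⟨t, ht, h1, h2, h3, h4⟩
      obtain ⟨u, hu, rfl⟩ := Finset.mem_map.1 ht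
      exact ⟨u, hu, h2, h1, h4, h3⟩
    · rintro ⟨t, ht, h1, h2, h3, h4⟩
      exact ⟨t.swap, Finset.mem_map.2 ⟨t, ht, rfl⟩, h2, h1, h4, h3⟩
  set Cc : ℕ → ℝ := fun j => ∑ t ∈ (T.filter fun t => t.1 % 20 < 16 ∧ 16 ≤ t.2 % 20).filter
    (fun t => t.2 / 20 = j), w t with hCc
  have hCc' : ∀ j, Cc j = ∑ t ∈ starPairs T' j, pairCost Z g f t := by
    intro j
    rw [starPairs, hT', Finset.filter_map, Finset.sum_map, hCc]
    refine Finset.sum_congr ?_ fun t _ => (pairCost_swap Z f g t).symm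
    ext t
    rw [Finset.mem_filter, Finset.mem_filter, Finset.mem_filter]
    simp only [Function.comp_apply, Equiv.toEmbedding_apply,
      Equiv.prodComm_apply, Prod.fst_swap, Prod.snd_swap]
    tauto
  have hdC' : ∀ j, dC j = ((Finset.range N).filter (Linked T' j)).card := by
    intro j
    simp only [hdC]
    congr 1
    ext i
    simp [hlink]
  have hRstar : ∀ i, ∑ t ∈ starPairs T i, w t ≤ R i := by
    intro i
    refine Finset.sum_le_sum_of_subset_of_nonneg ?_ fun t _ _ => hw0 t
    intro t
    simp only [starPairs, Finset.mem_filter]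
    tauto
  have hrow : ∀ i < N, S * |1 - (dR i : ℤ)| ≤ R i ∧ (2 ≤ dR i → S * |1 - (dR i : ℤ)| + σ ≤ R i) := by
    intro i hi
    have := sum_starPairs_bound (g := g) hZ hf hfs h16 hσ hT hi (n := dR i) rfl
    exact ⟨this.1.trans (hRstar i), fun h => (this.2 h).trans (hRstar i)⟩
  have hcol : ∀ j < M, S * |1 - (dC j : ℤ)| ≤ Cc j ∧
      (2 ≤ dC j → S * |1 - (dC j : ℤ)| + σ ≤ Cc j) := by
    intro j hj
    rw [hCc']
    exact sum_starPairs_bound (g := f) hZ hg hgs h16 hσ hT's hj (hdC' j)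
  have hsplit : ∑ i ∈ Finset.range N, R i + ∑ j ∈ Finset.range M, Cc j ≤ ∑ t ∈ T, w t := by
    rw [Finset.sum_fiberwise_of_maps_to, Finset.sum_fiberwise_of_maps_to, ← Finset.sum_union]
    · refine Finset.sum_le_sum_of_subset_of_nonneg ?_ fun t _ _ => hw0 t
      exact Finset.union_subset (Finset.filter_subset _ _) (Finset.filter_subset _ _)
    · rw [Finset.disjoint_filter]
      intro t _ h1 h2
      omega
    · intro t ht
      rw [Finset.mem_filter] at ht
      exact Finset.mem_range.2 ((hT.lt_of_core ht.1).2 ht.2.2)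
    · intro t ht
      rw [Finset.mem_filter] at ht
      exact Finset.mem_range.2 ((hT.lt_of_core ht.1).1 ht.2)
  have hdeg : ∑ i ∈ Finset.range N, dR i = ∑ j ∈ Finset.range M, dC j :=
    Finset.sum_card_bipartiteAbove_eq_sum_card_bipartiteBelow (Linked T)
  set e := ∑ i ∈ Finset.range N, dR i with he
  set A := ∑ i ∈ Finset.range N, |1 - (dR i : ℤ)| with hA
  set B := ∑ j ∈ Finset.range M, |1 - (dC j : ℤ)| with hB
  have hA' : |(N : ℤ) - e| ≤ A := by
    refine le_trans (le_of_eq ?_) (Finset.abs_sum_le_sum_abs _ _)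
    rw [Finset.sum_sub_distrib, he]; simp
  have hB' : |(M : ℤ) - e| ≤ B := by
    refine le_trans (le_of_eq ?_) (Finset.abs_sum_le_sum_abs _ _)
    rw [Finset.sum_sub_distrib, hdeg]; simp
  -- `A` and `B` bound the distances of `N` and `M` to the common number of links `e`.
  have hgap : (G : ℤ) ≤ A + B := by
    rw [← hG, Int.natCast_natAbs]
    have := abs_sub_le (N : ℤ) e M
    rw [abs_sub_comm (e : ℤ) M] at this
    omega
  have hRsum : S * A ≤ ∑ i ∈ Finset.range N, R i := by
    rw [hA]; push_cast
    rw [Finset.mul_sum]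
    refine Finset.sum_le_sum fun i hi => ?_
    have := (hrow i (Finset.mem_range.1 hi)).1
    push_cast at this
    exact this
  have hCsum : S * B ≤ ∑ i ∈ Finset.range M, Cc i := by
    rw [hB]; push_cast
    rw [Finset.mul_sum]
    refine Finset.sum_le_sum fun i hi => ?_
    have := (hcol i (Finset.mem_range.1 hi)).1
    push_cast at this
    exact this
  -- These are integers, and one unit above `G` would cost a further `S ≥ σ`.
  have hAB : A + B = (G : ℤ) := by
    by_contra hne
    have h1 : (G : ℤ) + 1 ≤ A + B := by omega
    have h2 : (G : ℝ) + 1 ≤ A + B := by exact_mod_cast h1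
    have : S * ((G : ℝ) + 1) ≤ S * (A + B) :=
      mul_le_mul_of_nonneg_left h2 (by linarith)
    linarith
  have hABr : (A : ℝ) + B = G := by exact_mod_cast hAB
  -- All that is paid beyond `S |1 - degree|` totals less than `σ`; a single block of degree two or
  -- more would already exceed this.
  have hbudget : ∑ i ∈ Finset.range N, (R i - S * |1 - (dR i : ℤ)|) +
      ∑ j ∈ Finset.range M, (Cc j - S * |1 - (dC j : ℤ)|) < σ := by
    rw [Finset.sum_sub_distrib, Finset.sum_sub_distrib, ← Finset.mul_sum, ← Finset.mul_sum,
      ← Int.cast_sum, ← Int.cast_sum, ← hA, ← hB]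
    have : S * G = S * A + S * B := by rw [← hABr]; ring
    linarith
  have hRnn : ∀ i ∈ Finset.range N, 0 ≤ R i - S * |1 - (dR i : ℤ)| := fun i hi =>
    sub_nonneg.2 (hrow i (Finset.mem_range.1 hi)).1
  have hCnn : ∀ i ∈ Finset.range M, 0 ≤ Cc i - S * |1 - (dC i : ℤ)| := fun i hi =>
    sub_nonneg.2 (hcol i (Finset.mem_range.1 hi)).1
  have hR1 : ∀ i < N, R i - S * |1 - (dR i : ℤ)| < σ := by
    intro i hi
    have h1 := Finset.single_le_sum hRnn (Finset.mem_range.2 hi)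
    have h2 := Finset.sum_nonneg hCnn
    linarith
  have hC1 : ∀ j < M, Cc j - S * |1 - (dC j : ℤ)| < σ := by
    intro i hi
    have h1 := Finset.single_le_sum hCnn (Finset.mem_range.2 hi)
    have h2 := Finset.sum_nonneg hRnn
    linarith
  have hdR1 : ∀ i < N, dR i ≤ 1 := by
    intro i hi
    by_contra! h
    have := (hrow i hi).2 h
    linarith [hR1 i hi]
  have hdC1 : ∀ i < M, dC i ≤ 1 := by
    intro i hi
    by_contra! h
    have := (hcol i hi).2 h
    linarith [hC1 i hi]
  have hAe : A = N - e := by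
    rw [hA, Finset.sum_congr rfl (g := fun i => 1 - (dR i : ℤ)), Finset.sum_sub_distrib, he]
    · simp
    · intro i hi
      have := hdR1 i (Finset.mem_range.1 hi)
      exact abs_of_nonneg (by omega)
  have hBe : B = M - e := by
    rw [hB, Finset.sum_congr rfl (g := fun i => 1 - (dC i : ℤ)), Finset.sum_sub_distrib, hdeg]
    · simp
    · intro i hi
      have := hdC1 i (Finset.mem_range.1 hi)
      exact abs_of_nonneg (by omega)
  have hR_unique : ∀ i < N, ∀ j < M, ∀ j' < M, Linked T i j → Linked T i j' → j = j' := by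
    intro i hi j hj j' hj' h h'
    exact Finset.card_le_one.1 (hdR1 i hi) j (Finset.mem_filter.2 ⟨Finset.mem_range.2 hj, h⟩) j'
      (Finset.mem_filter.2 ⟨Finset.mem_range.2 hj', h'⟩)
  have hC_unique : ∀ j < M, ∀ i < N, ∀ i' < N, Linked T i j → Linked T i' j → i = i' := by
    intro j hj i hi i' hi' h h'
    exact Finset.card_le_one.1 (hdC1 j hj) i (Finset.mem_filter.2 ⟨Finset.mem_range.2 hi, h⟩) i'
      (Finset.mem_filter.2 ⟨Finset.mem_range.2 hi', h'⟩)
  -- A linked row costs less than `σ` in total. Hence its core vertices meet no star (cost at least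
  -- `Z`) and no core vertex in another position (cost at least `σ`); another block is excluded by
  -- the degree.
  have hpair : ∀ i < N, ∀ j < M, Linked T i j →
      ∑ k ∈ Finset.range 4, |f i k - g j k| ≤ R i := by
    intro i hi j hj hl
    have hd1 : dR i = 1 := by
      refine le_antisymm (hdR1 i hi) (Finset.card_pos.2 ⟨j, ?_⟩)
      exact Finset.mem_filter.2 ⟨Finset.mem_range.2 hj, hl⟩
    have hRi : R i < σ := by
      have := hR1 i hi
      rw [hd1] at this
      simpa using this
    have hmem : ∀ k < 4, (20 * i + 16 + k, 20 * j + 16 + k) ∈ T := by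
      intro k hk
      obtain ⟨y, hy⟩ := hT.left (20 * i + 16 + k) (by omega)
      have hyc : 16 ≤ y % 20 := by
        by_contra! hc
        have : (20 * i + 16 + k, y) ∈ starPairs T i := by
          rw [starPairs, Finset.mem_filter]
          refine ⟨hy, ?_, ?_, ?_⟩ <;> simp only <;> omega
        have := le_sum_starPairs_of_mem (f := f) (g := g) hZ hf hT this
        linarith [hRstar i]
      have hyj : y / 20 = j := by
        refine hR_unique i hi _ ((hT.lt_of_core hy).2 hyc) _ hj ⟨_, hy, ?_, hyc, ?_, rfl⟩ hl <;>
          simp only <;> omega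
      have hyk : k = y % 20 - 16 := by
        by_contra hne
        have h1 := hcross i hi j hj k hk (y % 20 - 16) (by omega) hne
        have h2 : w (20 * i + 16 + k, y) = |f i k - g j (y % 20 - 16)| := by
          rw [hw, pairCost, blockVal_core' hk, blockVal_core hyc, hyj]
        have h3 : w (20 * i + 16 + k, y) ≤ R i := by
          refine Finset.single_le_sum (fun t _ => hw0 t) ?_
          simp only [Finset.mem_filter]
          refine ⟨⟨hy, ?_⟩, ?_⟩ <;> omega
        linarith
      have : y = 20 * j + 16 + k := by omega
      rwa [this] at hy
    have h3 := sum_comp_le_sum_of_injOn (s := Finset.range 4)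
      (t := (T.filter fun t => 16 ≤ t.1 % 20).filter (fun t => t.1 / 20 = i))
      (fun k => (20 * i + 16 + k, 20 * j + 16 + k)) w (fun t _ => hw0 t)
      (by intro a _ b _ h; simp only [Prod.mk.injEq] at h; omega)
      (by
        intro k hk
        have hk := Finset.mem_range.1 hk
        simp only [Finset.mem_filter]
        refine ⟨⟨hmem k hk, ?_⟩, ?_⟩ <;> omega)
    refine le_trans (le_of_eq ?_) h3
    refine Finset.sum_congr rfl fun k hk => ?_
    have hk := Finset.mem_range.1 hk
    rw [hw, pairCost, blockVal_core' hk, blockVal_core' hk]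
  refine ⟨(Finset.range N ×ˢ Finset.range M).filter fun p => Linked T p.1 p.2, ?_, ?_, ?_, ?_⟩
  · intro p hp
    simpa using (Finset.mem_filter.1 hp).1
  · have hmono : ∀ i < N, ∀ i' < N, ∀ j < M, ∀ j' < M, Linked T i j → Linked T i' j' → i < i' →
        j < j' := by
      intro i hi i' hi' j hj j' hj' h h' hlt
      have hne : j ≠ j' := by
        rintro rfl
        exact absurd (hC_unique j hj i hi i' hi' h h') (by omega)
      obtain ⟨t, ht, a1, a2, a3, a4⟩ := h
      obtain ⟨u, hu, b1, b2, b3, b4⟩ := h'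
      have := hT.mono t ht u hu (by omega)
      omega
    intro p hp q hq
    simp only [Finset.mem_filter, Finset.mem_product, Finset.mem_range] at hp hq
    constructor
    · exact hmono _ hp.1.1 _ hq.1.1 _ hp.1.2 _ hq.1.2 hp.2 hq.2
    · intro hlt
      rcases lt_trichotomy p.1 q.1 with h | h | h
      · exact h
      · have := hR_unique p.1 hp.1.1 p.2 hp.1.2 q.2 hq.1.2 hp.2 (h ▸ hq.2)
        omega
      · have := hmono _ hq.1.1 _ hp.1.1 _ hq.1.2 _ hp.1.2 hq.2 hp.2 h
        omega
  · rw [Finset.card_filter, Finset.sum_product]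
    simp only [← Finset.card_filter]
    -- From `(N - e) + (M - e) = |N - M|`.
    have : (e : ℤ) = min N M := by omega
    exact_mod_cast this
  · rw [Finset.sum_filter, Finset.sum_product]
    simp only [← Finset.sum_filter]
    -- A row of degree 0 pays `S`, a row of degree 1 pays for its one aligned partner.
    have h1 : ∀ i ∈ Finset.range N, S * (1 - (dR i : ℤ) : ℤ) +
        ∑ j ∈ (Finset.range M).filter (Linked T i), ∑ k ∈ Finset.range 4, |f i k - g j k| ≤ R i := by
      intro i hi
      have hi' := Finset.mem_range.1 hi
      rcases Nat.le_one_iff_eq_zero_or_eq_one.1 (hdR1 i hi') with h0 | h1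
      · have hrow := (hrow i hi').1
        rw [h0] at hrow ⊢
        rw [Finset.card_eq_zero.1 h0]
        simpa using hrow
      · obtain ⟨j, hj⟩ := Finset.card_eq_one.1 h1
        have hjm : j ∈ (Finset.range M).filter (Linked T i) := by rw [hj]; simp
        rw [h1, hj]
        simp only [Finset.mem_filter, Finset.mem_range] at hjm
        simpa using hpair i hi' j hjm.1 hjm.2
    have h2 := Finset.sum_le_sum h1
    rw [Finset.sum_add_distrib, ← Finset.mul_sum, ← Int.cast_sum, Finset.sum_sub_distrib] at h2
    have h3 : ∑ i ∈ Finset.range N, (1 : ℤ) - ∑ i ∈ Finset.range N, (dR i : ℤ) = A := by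
      rw [hAe, he]; simp
    rw [h3] at h2
    have h4 : S * G = S * A + S * B := by rw [← hABr]; ring
    rw [h4]
    linarith

/-! ## Block curves as lists -/

/-- The curve made of `n` blocks with cores `f 0, …, f (n - 1)`. -/
def blockCurve (Z : ℝ) (f : ℕ → ℕ → ℝ) (n : ℕ) : List ℝ :=
  List.replicate 8 (-Z) ++ (List.range n).flatMap fun i =>
    List.replicate 8 (-Z) ++ [f i 0, f i 1, f i 2, f i 3] ++ List.replicate 8 (-Z)

theorem blockCurve_succ (Z : ℝ) (f : ℕ → ℕ → ℝ) (n : ℕ) :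
    blockCurve Z f (n + 1) = blockCurve Z f n ++
      (List.replicate 8 (-Z) ++ [f n 0, f n 1, f n 2, f n 3] ++ List.replicate 8 (-Z)) := by
  simp [blockCurve, List.range_succ, List.flatMap_append]

theorem length_blockCurve (Z : ℝ) (f : ℕ → ℕ → ℝ) (n : ℕ) :
    (blockCurve Z f n).length = 20 * n + 8 := by
  induction n with
  | zero => simp [blockCurve]
  | succ n ih => rw [blockCurve_succ, List.length_append, ih]; simp; omega

theorem getD_blockCurve (Z : ℝ) (f : ℕ → ℕ → ℝ) (n : ℕ) {x : ℕ} (hx : x < 20 * n + 8) :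
    (blockCurve Z f n).getD x 0 = blockVal Z f x := by
  induction n with
  | zero =>
    rw [blockVal_star (by omega)]
    simp only [blockCurve, List.range_zero, List.flatMap_nil, List.append_nil]
    rw [List.getD_eq_getElem _ _ (by simpa using hx), List.getElem_replicate]
  | succ n ih =>
    rw [blockCurve_succ]
    by_cases h : x < 20 * n + 8
    · rw [List.getD_append _ _ _ _ (by rwa [length_blockCurve]), ih h]
    · rw [List.getD_append_right _ _ _ _ (by rw [length_blockCurve]; omega), length_blockCurve]
      obtain ⟨y, rfl⟩ : ∃ y, x = 20 * n + 8 + y := ⟨x - (20 * n + 8), by omega⟩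
      have hy : y < 20 := by omega
      rw [Nat.add_sub_cancel_left]
      by_cases hc : 8 ≤ y ∧ y < 12
      · have : 20 * n + 8 + y = 20 * n + 16 + (y - 8) := by omega
        rw [this, blockVal_core' (by omega)]
        obtain ⟨h1, h2⟩ := hc
        interval_cases y <;> simp [List.replicate]
      · rw [blockVal_star (by omega)]
        interval_cases y <;> simp [List.replicate] <;> omega

/-! ## Traversals of block curves -/

/-- One statement for the three motions `(u, v) = (1, 1)`, `(1, 0)` and `(0, 1)`. -/
theorem IsGridPath.exists_iterate {P Q : List ℝ} {x y : ℕ} {π : List (ℕ × ℕ)}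
    (h : IsGridPath x y π) {u v : ℕ} (huv : ∀ a b, GridStep (a, b) (a + u, b + v)) (m : ℕ) :
    ∃ τ, IsGridPath (x + u * m) (y + v * m) τ ∧ traversalCost P Q τ = traversalCost P Q π +
      ∑ l ∈ Finset.range m, |P.getD (x + u * (l + 1)) 0 - Q.getD (y + v * (l + 1)) 0| := by
  induction m with
  | zero => exact ⟨π, by simpa using h, by simp⟩
  | succ m ih =>
    obtain ⟨τ, h1, h2⟩ := ih
    refine ⟨_, h1.concat (by
      simpa only [Nat.mul_succ, ← Nat.add_assoc] using huv (x + u * m) (y + v * m)), ?_⟩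
    rw [traversalCost_concat, h2, Finset.sum_range_succ]
    ring

theorem gridStep_diag (a b : ℕ) : GridStep (a, b) (a + 1, b + 1) := Or.inr (Or.inr rfl)

theorem gridStep_vert (a b : ℕ) : GridStep (a, b) (a + 1, b + 0) := Or.inl rfl

theorem gridStep_horiz (a b : ℕ) : GridStep (a, b) (a + 0, b + 1) := Or.inr (Or.inl rfl)

/-- From index `20 i + 7`, step `l` leads to `20 i + 8 + l`, a core vertex exactly for `8 ≤ l < 12`.
At the other steps star meets star. -/
theorem sum_range_twenty {h : ℕ → ℝ} (h0 : ∀ l < 20, ¬ (8 ≤ l ∧ l < 12) → h l = 0) :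
    ∑ l ∈ Finset.range 20, h l = ∑ k ∈ Finset.range 4, h (8 + k) := by
  simp only [Finset.sum_range_succ, Finset.sum_range_zero]
  have h1 : ∀ l < 8, h l = 0 := fun l hl => h0 l (by omega) (by omega)
  have h2 : ∀ l < 20, 12 ≤ l → h l = 0 := fun l hl hl' => h0 l hl (by omega)
  simp [h1, h2]

section Traversals

variable {Z : ℝ} {f g : ℕ → ℕ → ℝ} {N M i j : ℕ} {π : List (ℕ × ℕ)}

theorem exists_traversal_start : ∃ τ, IsGridPath 7 7 τ ∧
    traversalCost (blockCurve Z f N) (blockCurve Z g M) τ = 0 := by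
  have hs : ∀ (h : ℕ → ℕ → ℝ) (n x : ℕ), x < 8 → (blockCurve Z h n).getD x 0 = -Z := by
    intro h n x hx
    rw [getD_blockCurve _ _ _ (by omega), blockVal_star (by omega)]
  obtain ⟨τ, h1, h2⟩ := isGridPath_singleton.exists_iterate (P := blockCurve Z f N)
    (Q := blockCurve Z g M) gridStep_diag 7
  refine ⟨τ, by simpa using h1, ?_⟩
  rw [h2, Finset.sum_eq_zero]
  · simp only [traversalCost, List.map_cons, List.map_nil, List.sum_cons, List.sum_nil]
    rw [hs _ _ _ (by omega), hs _ _ _ (by omega)]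
    simp
  · intro l hl
    have := Finset.mem_range.1 hl
    rw [hs _ _ _ (by omega), hs _ _ _ (by omega)]
    simp

theorem exists_traversal_diag (h : IsGridPath (20 * i + 7) (20 * j + 7) π) (hi : i < N)
    (hj : j < M) : ∃ τ, IsGridPath (20 * (i + 1) + 7) (20 * (j + 1) + 7) τ ∧
      traversalCost (blockCurve Z f N) (blockCurve Z g M) τ =
        traversalCost (blockCurve Z f N) (blockCurve Z g M) π +
          ∑ k ∈ Finset.range 4, |f i k - g j k| := by
  obtain ⟨τ, h1, h2⟩ := h.exists_iterate (P := blockCurve Z f N)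
    (Q := blockCurve Z g M) gridStep_diag 20
  refine ⟨τ, ?_, ?_⟩
  · convert h1 using 1 <;> ring
  · rw [h2, sum_range_twenty]
    · congr 1
      refine Finset.sum_congr rfl fun k hk => ?_
      have := Finset.mem_range.1 hk
      rw [getD_blockCurve _ _ _ (by omega), getD_blockCurve _ _ _ (by omega)]
      rw [show 20 * i + 7 + 1 * (8 + k + 1) = 20 * i + 16 + k by ring,
        show 20 * j + 7 + 1 * (8 + k + 1) = 20 * j + 16 + k by ring, blockVal_core' this,
        blockVal_core' this]
    · intro l hl hl'
      rw [getD_blockCurve _ _ _ (by omega), getD_blockCurve _ _ _ (by omega),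
        blockVal_star (by omega), blockVal_star (by omega)]
      simp

/-- The second curve waits on the star `20 * j + 7`; nonnegative core vertices turn each distance
into a sum. -/
theorem exists_traversal_vert (h : IsGridPath (20 * i + 7) (20 * j + 7) π) (hi : i < N)
    (hj : j ≤ M) (hZ : 0 ≤ Z) (hf : ∀ k < 4, 0 ≤ f i k) :
    ∃ τ, IsGridPath (20 * (i + 1) + 7) (20 * j + 7) τ ∧
      traversalCost (blockCurve Z f N) (blockCurve Z g M) τ =
        traversalCost (blockCurve Z f N) (blockCurve Z g M) π +
          (4 * Z + ∑ k ∈ Finset.range 4, f i k) := by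
  obtain ⟨τ, h1, h2⟩ := h.exists_iterate (P := blockCurve Z f N)
    (Q := blockCurve Z g M) gridStep_vert 20
  refine ⟨τ, ?_, ?_⟩
  · convert h1 using 1; ring
  · rw [h2, sum_range_twenty]
    · congr 1
      have h3 : ∀ k ∈ Finset.range 4, |(blockCurve Z f N).getD (20 * i + 7 + 1 * (8 + k + 1)) 0 -
          (blockCurve Z g M).getD (20 * j + 7 + 0 * (8 + k + 1)) 0| = Z + f i k := by
        intro k hk
        have := Finset.mem_range.1 hk
        rw [getD_blockCurve _ _ _ (by omega), getD_blockCurve _ _ _ (by omega)]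
        rw [show 20 * i + 7 + 1 * (8 + k + 1) = 20 * i + 16 + k by ring, blockVal_core' this,
          blockVal_star (by omega), abs_of_nonneg]
        · ring
        · linarith [hf k this]
      rw [Finset.sum_congr rfl h3, Finset.sum_add_distrib]
      simp
    · intro l hl hl'
      rw [getD_blockCurve _ _ _ (by omega), getD_blockCurve _ _ _ (by omega),
        blockVal_star (by omega), blockVal_star (by omega)]
      simp

theorem exists_traversal_horiz (h : IsGridPath (20 * i + 7) (20 * j + 7) π) (hi : i ≤ N)
    (hj : j < M) (hZ : 0 ≤ Z) (hg : ∀ k < 4, 0 ≤ g j k) :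
    ∃ τ, IsGridPath (20 * i + 7) (20 * (j + 1) + 7) τ ∧
      traversalCost (blockCurve Z f N) (blockCurve Z g M) τ =
        traversalCost (blockCurve Z f N) (blockCurve Z g M) π +
          (4 * Z + ∑ k ∈ Finset.range 4, g j k) := by
  obtain ⟨τ, h1, h2⟩ := h.exists_iterate (P := blockCurve Z f N)
    (Q := blockCurve Z g M) gridStep_horiz 20
  refine ⟨τ, ?_, ?_⟩
  · convert h1 using 1; ring
  · rw [h2, sum_range_twenty]
    · congr 1
      have h3 : ∀ k ∈ Finset.range 4, |(blockCurve Z f N).getD (20 * i + 7 + 0 * (8 + k + 1)) 0 -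
          (blockCurve Z g M).getD (20 * j + 7 + 1 * (8 + k + 1)) 0| = Z + g j k := by
        intro k hk
        have := Finset.mem_range.1 hk
        rw [getD_blockCurve _ _ _ (by omega), getD_blockCurve _ _ _ (by omega)]
        rw [show 20 * j + 7 + 1 * (8 + k + 1) = 20 * j + 16 + k by ring, blockVal_core' this,
          blockVal_star (by omega), abs_sub_comm, abs_of_nonneg]
        · ring
        · linarith [hg k this]
      rw [Finset.sum_congr rfl h3, Finset.sum_add_distrib]
      simp
    · intro l hl hl'
      rw [getD_blockCurve _ _ _ (by omega), getD_blockCurve _ _ _ (by omega),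
        blockVal_star (by omega), blockVal_star (by omega)]
      simp

end Traversals

/-! ## The gadget curves -/

theorem getD_le_listMax (l : List ℕ) (i : ℕ) : l.getD i 0 ≤ listMax l := by
  induction l generalizing i with
  | nil => simp
  | cons x l ih =>
    cases i with
    | zero => simp [listMax]
    | succ i =>
      have := ih i
      simp only [listMax, List.foldr_cons, List.getD_cons_succ] at this ⊢
      omega

namespace Intermediary

/-- The four core vertices of a row gadget. -/
noncomputable def rowVal (V r d : ℝ) (k : ℕ) : ℝ :=
  if k = 0 then V ^ 4 + 2 * r * V ^ 3 + d / 4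
  else if k = 1 then 2 * V ^ 4 + 2 * r * V ^ 3 - d / 4
  else if k = 2 then 3 * V ^ 4 - 2 * r * V ^ 3 + d / 4
  else 4 * V ^ 4 - 2 * r * V ^ 3 - d / 4

/-- The four core vertices of a column gadget. -/
noncomputable def colVal (V c : ℝ) (b : Bool) (k : ℕ) : ℝ :=
  if k = 0 then V ^ 4 + 2 * c * V ^ 3 - V
  else if k = 1 then 2 * V ^ 4 + 2 * c * V ^ 3 + V
  else if k = 2 then 3 * V ^ 4 - 2 * c * V ^ 3 + (-1) ^ b.toNat * V
  else 4 * V ^ 4 - 2 * c * V ^ 3 - (-1) ^ b.toNat * V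

/-- The core vertices of `I.curveP V`. -/
noncomputable def rowCore (I : Intermediary) (V : ℝ) (i k : ℕ) : ℝ :=
  rowVal V (I.r.getD i 0) (I.d.getD i 0) k

/-- The core vertices of `I.curveQ V`. -/
noncomputable def colCore (I : Intermediary) (V : ℝ) (j k : ℕ) : ℝ :=
  colVal V (I.c.getD j 0) (I.b.getD j false) k

theorem curveP_eq (I : Intermediary) (V : ℝ) :
    I.curveP V = blockCurve (V ^ 5) (I.rowCore V) (I.nr - 1) := by
  simp [curveP, blockCurve, rowGadget, stars, rowCore, rowVal]

theorem curveQ_eq (I : Intermediary) (V : ℝ) :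
    I.curveQ V = blockCurve (V ^ 5) (I.colCore V) (I.nc - 1) := by
  simp [curveQ, blockCurve, colGadget, stars, colCore, colVal]

theorem nr_pos (I : Intermediary) : 1 ≤ I.nr := List.length_pos_of_ne_nil I.r_ne

theorem nc_pos (I : Intermediary) : 1 ≤ I.nc := List.length_pos_of_ne_nil I.c_ne

theorem U_pos (I : Intermediary) : 1 ≤ I.U := Nat.one_le_of_lt I.U_gt

/-- Both curves omit their last gadget, so the difference of the numbers of blocks is unchanged. -/
theorem gap_eq (I : Intermediary) :
    I.gap = (((I.nr - 1 : ℕ) : ℤ) - (I.nc - 1 : ℕ)).natAbs := by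
  have := I.nr_pos
  have := I.nc_pos
  unfold gap
  congr 1
  omega

/-- The identifier enters with signs `+ + - -` and the weight with `+ - + -`, so skipping a block
has the same price for all rows. -/
theorem sum_rowCore (I : Intermediary) (V : ℝ) (i : ℕ) :
    ∑ k ∈ Finset.range 4, I.rowCore V i k = 10 * V ^ 4 := by
  simp [Finset.sum_range_succ, rowCore, rowVal]
  ring

theorem sum_colCore (I : Intermediary) (V : ℝ) (j : ℕ) :
    ∑ k ∈ Finset.range 4, I.colCore V j k = 10 * V ^ 4 := by
  simp [Finset.sum_range_succ, colCore, colVal]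
  ring

end Intermediary

/-! ### Matchings as grid paths, and the size of the parameter -/

namespace Intermediary

/-- The paths of the grid that follow a monotone matching. -/
theorem exists_path_of_matching (I : Intermediary) (a b : ℕ)
    (E : Finset (ℕ × ℕ)) (hE : ∀ p ∈ E, p.1 < a ∧ p.2 < b)
    (hm : ∀ p ∈ E, ∀ q ∈ E, p.1 < q.1 ↔ p.2 < q.2) :
    ∃ π, IsGridPath a b π ∧ I.pathLength π = I.U * (a + b - 2 * E.card) +
      ∑ p ∈ E, I.weight p (p.1 + 1, p.2 + 1) := by
  induction hn : a + b using Nat.strong_induction_on generalizing a b E with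
  | _ n ih =>
    by_cases hrow : ∃ p ∈ E, p.1 + 1 = a
    · by_cases hcol : ∃ q ∈ E, q.2 + 1 = b
      · obtain ⟨p, hp, hpa⟩ := hrow
        obtain ⟨q, hq, hqb⟩ := hcol
        -- If `p` were not in the last column, then `q`, which is further right, would lie below the
        -- last row.
        have hpb : p.2 + 1 = b := by
          have := hE p hp
          have := hE q hq
          have h1 := (hm p hp q hq).not
          omega
        subst hpa
        subst hpb
        have hlt : ∀ r ∈ E.erase p, r.1 < p.1 ∧ r.2 < p.2 := by
          intro r hr
          have hrE := Finset.mem_of_mem_erase hr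
          have hne := Finset.ne_of_mem_erase hr
          have h1 := hm r hrE p hp
          have h2 := hm p hp r hrE
          have h3 := hE r hrE
          have h4 : ¬ (r.1 = p.1 ∧ r.2 = p.2) := fun h => hne (Prod.ext h.1 h.2)
          omega
        obtain ⟨π, h1, h2⟩ := ih (p.1 + p.2) (by omega) p.1 p.2 (E.erase p) hlt
          (fun r hr s hs => hm r (Finset.mem_of_mem_erase hr) s (Finset.mem_of_mem_erase hs)) rfl
        refine ⟨_, h1.concat (gridStep_diag _ _), ?_⟩
        rw [I.pathLength_concat h1, h2, ← Finset.add_sum_erase E _ hp, Finset.card_erase_of_mem hp,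
          Nat.cast_sub (Finset.card_pos.2 ⟨p, hp⟩)]
        push_cast
        ring
      -- The last column is unmatched, so the path ends with a horizontal edge.
      · push Not at hcol
        by_cases hb : b = 0
        · obtain ⟨p, hp, hpa⟩ := hrow
          have := hE p hp
          omega
        · obtain ⟨b, rfl⟩ := Nat.exists_eq_succ_of_ne_zero hb
          obtain ⟨π, h1, h2⟩ := ih (a + b) (by omega) a b E
            (fun p hp => by have := hE p hp; have := hcol p hp; omega) hm rfl
          refine ⟨_, h1.concat (gridStep_horiz _ _), ?_⟩
          rw [I.pathLength_concat h1, h2, weight, if_neg (by simp)]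
          push_cast
          ring
    · push Not at hrow
      by_cases ha : a = 0
      · by_cases hb : b = 0
        · subst ha
          subst hb
          have : E = ∅ := Finset.eq_empty_of_forall_notMem fun p hp => by
            have := hE p hp; omega
          subst this
          exact ⟨_, isGridPath_singleton, by simp [pathLength]⟩
        · obtain ⟨b, rfl⟩ := Nat.exists_eq_succ_of_ne_zero hb
          obtain ⟨π, h1, h2⟩ := ih (a + b) (by omega) a b E
            (fun p hp => by have := hE p hp; omega) hm rfl
          refine ⟨_, h1.concat (gridStep_horiz _ _), ?_⟩
          rw [I.pathLength_concat h1, h2, weight, if_neg (by simp)]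
          push_cast
          ring
      · obtain ⟨a, rfl⟩ := Nat.exists_eq_succ_of_ne_zero ha
        obtain ⟨π, h1, h2⟩ := ih (a + b) (by omega) a b E
          (fun p hp => by have := hE p hp; have := hrow p hp; omega) hm rfl
        refine ⟨_, h1.concat (gridStep_vert _ _), ?_⟩
        rw [I.pathLength_concat h1, h2, weight, if_neg (by simp)]
        push_cast
        ring

/-! ### Size estimates -/

/-- Admissible values of the parameter of the gadget curves. -/
def Admissible (I : Intermediary) (V : ℕ) : Prop :=
  I.U ≤ V ∧ I.nr * I.nc * (max 1 (listMax I.d) * max 1 (listMax I.r) * max 1 (listMax I.c)) ^ 2 < V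

/-- The slack of the lower bound. -/
noncomputable def slack (I : Intermediary) (V : ℕ) : ℝ :=
  4 * V * (min (I.nr - 1) (I.nc - 1) : ℕ) + √(I.U : ℝ)

section Estimates

variable {I : Intermediary} {V : ℕ}

/-- Specializing the factors, often to `1`, yields the numerical bounds below; `max 1` prevents a
vanishing maximum from annihilating the product. -/
theorem Admissible.mul_sq_lt (h : I.Admissible V) {m d r c : ℕ} (hm : m ≤ I.nr * I.nc)
    (hd : d ≤ max 1 (listMax I.d)) (hr : r ≤ max 1 (listMax I.r))
    (hc : c ≤ max 1 (listMax I.c)) : m * (d * r * c) ^ 2 < V := by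
  refine lt_of_le_of_lt ?_ h.2
  gcongr

theorem Admissible.row_bounds (h : I.Admissible V) (h2 : 2 ≤ I.nr * I.nc) (i : ℕ) :
    2 * I.r.getD i 0 < V ∧ 2 * I.d.getD i 0 < V := by
  have hr := getD_le_listMax I.r i
  have hd := getD_le_listMax I.d i
  have h1 := h.mul_sq_lt h2 (d := 1) (r := I.r.getD i 0) (c := 1) (by omega) (by omega) (by omega)
  have h2 := h.mul_sq_lt h2 (d := I.d.getD i 0) (r := 1) (c := 1) (by omega) (by omega) (by omega)
  constructor <;> nlinarith [Nat.le_self_pow (n := 2) (by norm_num) (I.r.getD i 0),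
    Nat.le_self_pow (n := 2) (by norm_num) (I.d.getD i 0)]

/-- Raised to at least `1`, the identifiers are both bounded by their product, and four times its
square is below `V`. -/
theorem Admissible.two_mul_add_lt (h : I.Admissible V) (h2 : 4 ≤ I.nr * I.nc) (i j : ℕ) :
    2 * I.r.getD i 0 + 2 * I.c.getD j 0 < V := by
  have hr := getD_le_listMax I.r i
  have hc := getD_le_listMax I.c j
  have h1 := h.mul_sq_lt h2 (d := 1) (r := max 1 (I.r.getD i 0)) (c := max 1 (I.c.getD j 0))
    (by omega) (by omega) (by omega)
  obtain ⟨x, hx⟩ : ∃ x, max 1 (I.r.getD i 0) = x + 1 := ⟨max 1 (I.r.getD i 0) - 1, by omega⟩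
  obtain ⟨y, hy⟩ : ∃ y, max 1 (I.c.getD j 0) = y + 1 := ⟨max 1 (I.c.getD j 0) - 1, by omega⟩
  rw [hx, hy] at h1
  have h3 : I.r.getD i 0 ≤ x + 1 := by omega
  have h4 : I.c.getD j 0 ≤ y + 1 := by omega
  have h5 : 1 * ((x + 1) * (y + 1)) = x * y + x + y + 1 := by ring
  rw [one_mul] at h5 h1
  rw [h5] at h1
  nlinarith [Nat.zero_le (x * y), Nat.le_self_pow (n := 2) (by norm_num) (x * y + x + y + 1)]

theorem Admissible.one_lt (h : I.Admissible V) : 1 < V := by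
  have h1 := h.mul_sq_lt (m := 1) (d := 1) (r := 1) (c := 1)
    (Nat.mul_pos I.nr_pos I.nc_pos) (by omega) (by omega) (by omega)
  omega

theorem Admissible.min_bound (h : I.Admissible V) :
    (min (I.nr - 1) (I.nc - 1) + 1) ^ 2 < V := by
  have h1 := h.mul_sq_lt (m := I.nr * I.nc) (d := 1) (r := 1) (c := 1) le_rfl
    (by omega) (by omega) (by omega)
  have hr := I.nr_pos
  have hc := I.nc_pos
  have h2 : min (I.nr - 1) (I.nc - 1) + 1 ≤ I.nr := by omega
  have h3 : min (I.nr - 1) (I.nc - 1) + 1 ≤ I.nc := by omega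
  have := Nat.mul_le_mul h2 h3
  nlinarith

theorem Admissible.sqrt_le (h : I.Admissible V) : √(I.U : ℝ) ≤ V := by
  rw [Real.sqrt_le_left (by positivity)]
  have h1 : (I.U : ℝ) ≤ V := by exact_mod_cast h.1
  have h2 : (1 : ℝ) ≤ V := by exact_mod_cast h.one_lt.le
  nlinarith

theorem slack_nonneg : 0 ≤ I.slack V := by
  unfold slack; positivity

/-- With `k` the minimum, `(k + 1)^2 < V` gives `4 k + 3 ≤ V^2`, hence `(4 k + 1) V ≤ V^3 - 2 V`.
The right-hand side is a lower bound for the cost of misaligned cores and of different identifiers.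
-/
theorem Admissible.slack_le (h : I.Admissible V) (hk : 1 ≤ min (I.nr - 1) (I.nc - 1)) :
    I.slack V ≤ (V : ℝ) ^ 3 - 2 * V := by
  have h1 := h.min_bound
  have h2 := h.sqrt_le
  unfold slack
  generalize min (I.nr - 1) (I.nc - 1) = k at *
  have h3 : 4 * k + 3 ≤ V ^ 2 := by
    have h5 : 2 * k + 2 ≤ V := by nlinarith
    nlinarith
  have h4 : (4 * k + 3 : ℝ) ≤ V ^ 2 := by exact_mod_cast h3
  have h5 := mul_le_mul_of_nonneg_left h4 (Nat.cast_nonneg (α := ℝ) V)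
  nlinarith

/-- Includes the case of a curve without blocks, where the slack is only `√U ≤ V`. -/
theorem Admissible.slack_le_pow (h : I.Admissible V) : I.slack V ≤ (V : ℝ) ^ 3 := by
  have hV : (1 : ℝ) ≤ V := by exact_mod_cast h.one_lt.le
  rcases Nat.eq_zero_or_pos (min (I.nr - 1) (I.nc - 1)) with h0 | h1
  · have h2 := h.sqrt_le
    unfold slack
    rw [h0]
    have : (V : ℝ) ≤ (V : ℝ) ^ 3 := le_self_pow₀ hV (by norm_num)
    simp
    linarith
  · have := h.slack_le h1
    linarith

theorem two_le_nr_mul_nc {i : ℕ} (hi : i < I.nr - 1) : 2 ≤ I.nr * I.nc := by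
  have := Nat.mul_le_mul (show 2 ≤ I.nr by omega) I.nc_pos
  omega

theorem two_le_nr_mul_nc' {j : ℕ} (hj : j < I.nc - 1) : 2 ≤ I.nr * I.nc := by
  have := Nat.mul_le_mul I.nr_pos (show 2 ≤ I.nc by omega)
  omega

theorem four_le_nr_mul_nc {i j : ℕ} (hi : i < I.nr - 1) (hj : j < I.nc - 1) :
    4 ≤ I.nr * I.nc := by
  have := Nat.mul_le_mul (show 2 ≤ I.nr by omega) (show 2 ≤ I.nc by omega)
  omega

theorem Admissible.rowCore_nonneg (h : I.Admissible V) {i : ℕ} (hi : i < I.nr - 1) (k : ℕ) :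
    0 ≤ I.rowCore V i k := by
  obtain ⟨h1, h2⟩ := h.row_bounds (two_le_nr_mul_nc hi) i
  have h3 : 2 * (I.r.getD i 0 : ℝ) ≤ V := by exact_mod_cast h1.le
  have h4 : 2 * (I.d.getD i 0 : ℝ) ≤ V := by exact_mod_cast h2.le
  have hV : (1 : ℝ) ≤ V := by exact_mod_cast h.one_lt.le
  have h5 : (0 : ℝ) ≤ I.d.getD i 0 := Nat.cast_nonneg _
  have h6 : (V : ℝ) ≤ (V : ℝ) ^ 4 := le_self_pow₀ hV (by norm_num)
  have h7 : 0 ≤ 2 * (I.r.getD i 0 : ℝ) * (V : ℝ) ^ 3 := by positivity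
  have h8 : 2 * (I.r.getD i 0 : ℝ) * (V : ℝ) ^ 3 ≤ (V : ℝ) ^ 4 := by
    calc _ ≤ (V : ℝ) * (V : ℝ) ^ 3 := by gcongr
      _ = _ := by ring
  unfold rowCore rowVal
  split_ifs <;> linarith

theorem Admissible.colCore_nonneg (h : I.Admissible V) {j : ℕ} (hj : j < I.nc - 1) (k : ℕ) :
    0 ≤ I.colCore V j k := by
  have hc := getD_le_listMax I.c j
  have h1 := h.mul_sq_lt (two_le_nr_mul_nc' hj) (d := 1) (r := 1) (c := I.c.getD j 0)
    (by omega) (by omega) (by omega)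
  have h3 : 2 * (I.c.getD j 0 : ℝ) ≤ V := by
    have : 2 * I.c.getD j 0 ≤ V := by
      nlinarith [Nat.le_self_pow (n := 2) (by norm_num) (I.c.getD j 0)]
    exact_mod_cast this
  have hV : (1 : ℝ) ≤ V := by exact_mod_cast h.one_lt.le
  have h6 : (V : ℝ) ≤ (V : ℝ) ^ 4 := le_self_pow₀ hV (by norm_num)
  have h7 : 0 ≤ 2 * (I.c.getD j 0 : ℝ) * (V : ℝ) ^ 3 := by positivity
  have h8 : 2 * (I.c.getD j 0 : ℝ) * (V : ℝ) ^ 3 ≤ (V : ℝ) ^ 4 := by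
    calc _ ≤ (V : ℝ) * (V : ℝ) ^ 3 := by gcongr
      _ = _ := by ring
  unfold colCore colVal
  cases I.b.getD j false <;> simp only [Bool.toNat_true, Bool.toNat_false, pow_one, pow_zero] <;>
    split_ifs <;> linarith

/-- The leading terms of different positions differ by at least `V^4`. The identifiers consume at
most `V^4 - V^3` of this, by `two_mul_add_lt`, and the terms `d / 4` and `V` together at most `2 V`.
-/
theorem Admissible.slack_le_abs_sub (h : I.Admissible V) {i j k l : ℕ} (hi : i < I.nr - 1)
    (hj : j < I.nc - 1) (hk : k < 4) (hl : l < 4) (hkl : k ≠ l) :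
    I.slack V ≤ |I.rowCore V i k - I.colCore V j l| := by
  refine (h.slack_le (by omega)).trans ?_
  have h1 : 2 * (I.r.getD i 0 : ℝ) + 2 * I.c.getD j 0 + 1 ≤ V := by
    exact_mod_cast h.two_mul_add_lt (four_le_nr_mul_nc hi hj) i j
  have h4 : 2 * (I.d.getD i 0 : ℝ) ≤ V := by
    exact_mod_cast (h.row_bounds (two_le_nr_mul_nc hi) i).2.le
  have hV : (1 : ℝ) ≤ V := by exact_mod_cast h.one_lt.le
  have h5 : (0 : ℝ) ≤ I.d.getD i 0 := Nat.cast_nonneg _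
  have h7 : 0 ≤ 2 * (I.r.getD i 0 : ℝ) * (V : ℝ) ^ 3 := by positivity
  have h7' : 0 ≤ 2 * (I.c.getD j 0 : ℝ) * (V : ℝ) ^ 3 := by positivity
  have h8 : 2 * (I.r.getD i 0 : ℝ) * (V : ℝ) ^ 3 + 2 * (I.c.getD j 0 : ℝ) * (V : ℝ) ^ 3 +
      (V : ℝ) ^ 3 ≤ (V : ℝ) ^ 4 := by
    calc _ = (2 * (I.r.getD i 0 : ℝ) + 2 * I.c.getD j 0 + 1) * (V : ℝ) ^ 3 := by ring
      _ ≤ (V : ℝ) * (V : ℝ) ^ 3 := by gcongr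
      _ = _ := by ring
  rw [le_abs]
  unfold rowCore rowVal colCore colVal
  generalize (I.d.getD i 0 : ℝ) = d at *
  generalize 2 * (I.r.getD i 0 : ℝ) * (V : ℝ) ^ 3 = X at *
  generalize 2 * (I.c.getD j 0 : ℝ) * (V : ℝ) ^ 3 = Y at *
  have h9 : 0 ≤ (V : ℝ) ^ 3 := by positivity
  cases I.b.getD j false <;> simp only [Bool.toNat_true, Bool.toNat_false, pow_one, pow_zero] <;>
    interval_cases k <;> interval_cases l <;> first
      | exact absurd rfl hkl
      | (norm_num; left; linarith)
      | (norm_num; right; linarith)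

/-- The first core vertices suffice: different identifiers move them at least `2 V^3` apart, up to
`d / 4 + V`. -/
theorem Admissible.slack_le_of_ne (h : I.Admissible V) {i j : ℕ} (hi : i < I.nr - 1)
    (hj : j < I.nc - 1) (hrc : I.r.getD i 0 ≠ I.c.getD j 0) :
    I.slack V ≤ ∑ k ∈ Finset.range 4, |I.rowCore V i k - I.colCore V j k| := by
  refine le_trans ?_ (Finset.single_le_sum (f := fun k => |I.rowCore V i k - I.colCore V j k|)
    (fun _ _ => abs_nonneg _) (Finset.mem_range.2 (show 0 < 4 by norm_num)))
  refine (h.slack_le (by omega)).trans ?_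
  have h4 : 2 * (I.d.getD i 0 : ℝ) ≤ V := by
    exact_mod_cast (h.row_bounds (two_le_nr_mul_nc hi) i).2.le
  have h5 : (0 : ℝ) ≤ I.d.getD i 0 := Nat.cast_nonneg _
  have h9 : 0 ≤ (V : ℝ) ^ 3 := by positivity
  simp only [rowCore, rowVal, colCore, colVal, if_true]
  rw [le_abs]
  rcases lt_or_gt_of_ne hrc with hlt | hlt
  · have h1 : (I.r.getD i 0 : ℝ) + 1 ≤ I.c.getD j 0 := by exact_mod_cast hlt
    have h2 := mul_le_mul_of_nonneg_right h1 h9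
    right
    linarith
  · have h1 : (I.c.getD j 0 : ℝ) + 1 ≤ I.r.getD i 0 := by exact_mod_cast hlt
    have h2 := mul_le_mul_of_nonneg_right h1 h9
    left
    linarith

/-- Equal identifiers cancel and `d / 4 ≤ V` fixes all signs. The first two distances are `V + d /
4`; the last two are `V + d / 4` if the Boolean is true and `V - d / 4` if it is false. -/
theorem Admissible.sum_abs_of_eq (h : I.Admissible V) {i j : ℕ} (hi : i < I.nr - 1)
    (hrc : I.r.getD i 0 = I.c.getD j 0) :
    ∑ k ∈ Finset.range 4, |I.rowCore V i k - I.colCore V j k| =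
      4 * V + I.weight (i, j) (i + 1, j + 1) := by
  have h4 : 2 * (I.d.getD i 0 : ℝ) ≤ V := by
    exact_mod_cast (h.row_bounds (two_le_nr_mul_nc hi) i).2.le
  have h5 : (0 : ℝ) ≤ I.d.getD i 0 := Nat.cast_nonneg _
  simp only [weight, if_true, if_pos hrc]
  simp only [Finset.sum_range_succ, Finset.sum_range_zero, rowCore, rowVal, colCore, colVal, hrc,
    if_true, one_ne_zero, if_false, OfNat.ofNat_ne_zero, OfNat.ofNat_ne_one, Nat.succ_ne_self]
  generalize (I.d.getD i 0 : ℝ) = d at *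
  generalize 2 * (I.c.getD j 0 : ℝ) * (V : ℝ) ^ 3 = X
  generalize (V : ℝ) ^ 4 = A
  have e0 : |A + X + d / 4 - (A + X - V)| = V + d / 4 := by
    rw [abs_of_nonneg] <;> linarith
  have e1 : |2 * A + X - d / 4 - (2 * A + X + V)| = V + d / 4 := by
    rw [abs_of_nonpos] <;> linarith
  rw [e0, e1]
  cases I.b.getD j false
  · simp only [Bool.toNat_false, pow_zero]
    rw [abs_of_nonpos (by linarith), abs_of_nonneg (by linarith)]
    push_cast
    ring
  · simp only [Bool.toNat_true, pow_one]
    rw [abs_of_nonneg (by linarith), abs_of_nonpos (by linarith)]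
    push_cast
    ring

end Estimates

/-! ### Correctness of the gadget curves -/

/-- Expressed in the cost of the traversal, the threshold is the budget of
`Correspondence.exists_matching` with `σ = slack`. -/
theorem exists_path_of_traversal (I : Intermediary) {V : ℕ} (h : I.Admissible V)
    {τ : List (ℕ × ℕ)}
    (hτ : IsGridPath (20 * (I.nr - 1) + 7) (20 * (I.nc - 1) + 7) τ)
    (hlt : traversalCost (I.curveP V) (I.curveQ V) τ - I.offset V < I.U * I.gap + √(I.U : ℝ)) :
    ∃ π, IsGridPath (I.nr - 1) (I.nc - 1) π ∧
      I.pathLength π ≤ traversalCost (I.curveP V) (I.curveQ V) τ - I.offset V := by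
  have hV : (1 : ℝ) ≤ V := by exact_mod_cast h.one_lt.le
  have hT := hτ.correspondence.1
  have hcost : traversalCost (I.curveP V) (I.curveQ V) τ =
      ∑ t ∈ τ.toFinset, pairCost ((V : ℝ) ^ 5) (I.rowCore V) (I.colCore V) t := by
    rw [hτ.traversalCost_eq, curveP_eq, curveQ_eq]
    refine Finset.sum_congr rfl fun t ht => ?_
    have := hT.le t ht
    rw [pairCost, getD_blockCurve _ _ _ (by omega), getD_blockCurve _ _ _ (by omega)]
  have hoff : I.offset V = (4 * (V : ℝ) ^ 5 + 10 * (V : ℝ) ^ 4) * I.gap - I.U * I.gap +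
      4 * V * (min (I.nr - 1) (I.nc - 1) : ℕ) := by
    unfold offset; ring
  have hσ := h.slack_le_pow
  have h35 : (V : ℝ) ^ 3 ≤ (V : ℝ) ^ 5 := pow_le_pow_right₀ hV (by norm_num)
  have h45 : (V : ℝ) ^ 4 ≤ (V : ℝ) ^ 5 := pow_le_pow_right₀ hV (by norm_num)
  have h5 : (0 : ℝ) ≤ (V : ℝ) ^ 5 := by positivity
  obtain ⟨E, hE, hm, hcard, hle⟩ := hT.exists_matching (Z := (V : ℝ) ^ 5) (s₀ := 10 * (V : ℝ) ^ 4)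
    (σ := I.slack V) (f := I.rowCore V) (g := I.colCore V)
    (fun i hi k _ => h.rowCore_nonneg hi k) (fun j hj k _ => h.colCore_nonneg hj k)
    (fun i _ => I.sum_rowCore V i) (fun j _ => I.sum_colCore V j) slack_nonneg (by positivity)
    (by linarith) (by linarith)
    (fun i hi j hj k hk l hl hkl => h.slack_le_abs_sub hi hj hk hl hkl)
    (by
      rw [← hcost, ← I.gap_eq, slack]
      rw [hoff] at hlt
      linarith)
  rw [← hcost, ← I.gap_eq] at hle
  have hpos : ∀ p ∈ E, (0 : ℝ) ≤ ∑ k ∈ Finset.range 4, |I.rowCore V p.1 k - I.colCore V p.2 k| :=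
    fun p _ => Finset.sum_nonneg fun _ _ => abs_nonneg _
  have heq : ∀ p ∈ E, ∑ k ∈ Finset.range 4, |I.rowCore V p.1 k - I.colCore V p.2 k| =
      4 * V + I.weight p (p.1 + 1, p.2 + 1) := by
    intro p hp
    refine h.sum_abs_of_eq (hE p hp).1 ?_
    -- A matched pair with different identifiers would use up the whole slack.
    by_contra hne
    have h1 := h.slack_le_of_ne (hE p hp).1 (hE p hp).2 hne
    have h2 := Finset.single_le_sum hpos hp
    rw [hoff] at hlt
    unfold slack at h1
    linarith
  rw [Finset.sum_congr rfl heq, Finset.sum_add_distrib, Finset.sum_const, hcard,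
    nsmul_eq_mul] at hle
  obtain ⟨π, hπ, hlen⟩ := I.exists_path_of_matching _ _ E hE hm
  refine ⟨π, hπ, ?_⟩
  -- The number of non-diagonal edges left by a maximal matching.
  have hg : (((I.nr - 1 : ℕ) : ℝ) + (I.nc - 1 : ℕ) - 2 * (min (I.nr - 1) (I.nc - 1) : ℕ)) =
      I.gap := by
    have : ((I.nr - 1 : ℕ) : ℤ) + (I.nc - 1 : ℕ) - 2 * (min (I.nr - 1) (I.nc - 1) : ℕ) =
        I.gap := by
      rw [I.gap_eq]; omega
    exact_mod_cast this
  rw [hlen, hcard, hg, hoff]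
  linarith

/-- `m` counts the diagonal edges and `s` adds their weights. A diagonal edge between different
identifiers is not simulated; it lifts `s` to `√U`, and `s` never decreases afterwards. -/
theorem exists_traversal_of_prefix (I : Intermediary) {V : ℕ} (h : I.Admissible V) {a b : ℕ}
    {π : List (ℕ × ℕ)} (hπ : IsGridPath a b π) (ha : a ≤ I.nr - 1) (hb : b ≤ I.nc - 1) :
    ∃ (m : ℕ) (s : ℝ), m ≤ a ∧ m ≤ b ∧ 0 ≤ s ∧ I.pathLength π = I.U * (a + b - 2 * m) + s ∧
      (√(I.U : ℝ) ≤ s ∨ ∃ τ, IsGridPath (20 * a + 7) (20 * b + 7) τ ∧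
        traversalCost (I.curveP V) (I.curveQ V) τ =
          (4 * (V : ℝ) ^ 5 + 10 * (V : ℝ) ^ 4) * (a + b - 2 * m) + 4 * V * m + s) := by
  have hZ : (0 : ℝ) ≤ (V : ℝ) ^ 5 := by positivity
  rw [curveP_eq, curveQ_eq]
  revert ha hb
  refine hπ.induction (motive := fun a b π => a ≤ I.nr - 1 → b ≤ I.nc - 1 →
    ∃ (m : ℕ) (s : ℝ), m ≤ a ∧ m ≤ b ∧ 0 ≤ s ∧ I.pathLength π = I.U * (a + b - 2 * m) + s ∧
      (√(I.U : ℝ) ≤ s ∨ ∃ τ, IsGridPath (20 * a + 7) (20 * b + 7) τ ∧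
        traversalCost (blockCurve ((V : ℝ) ^ 5) (I.rowCore V) (I.nr - 1))
          (blockCurve ((V : ℝ) ^ 5) (I.colCore V) (I.nc - 1)) τ =
          (4 * (V : ℝ) ^ 5 + 10 * (V : ℝ) ^ 4) * (a + b - 2 * m) + 4 * V * m + s)) ?_ ?_
  · intro _ _
    obtain ⟨τ, h1, h2⟩ := exists_traversal_start (Z := (V : ℝ) ^ 5) (f := I.rowCore V)
      (g := I.colCore V) (N := I.nr - 1) (M := I.nc - 1)
    exact ⟨0, 0, le_rfl, le_rfl, le_rfl, by simp [pathLength], Or.inr ⟨τ, h1, by rw [h2]; simp⟩⟩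
  · intro a b a' b' π hπ hs ih ha hb
    simp only [GridStep, Prod.mk.injEq] at hs
    obtain ⟨m, s, hma, hmb, hs0, hlen, hor⟩ := ih (by omega) (by omega)
    rcases hs with ⟨rfl, rfl⟩ | ⟨rfl, rfl⟩ | ⟨rfl, rfl⟩
    · refine ⟨m, s, by omega, by omega, hs0, ?_, hor.imp_right ?_⟩
      · rw [I.pathLength_concat hπ, hlen, weight, if_neg (by simp)]
        push_cast; ring
      · rintro ⟨τ, h1, h2⟩
        obtain ⟨τ', h3, h4⟩ := exists_traversal_vert (Z := (V : ℝ) ^ 5) (f := I.rowCore V)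
          (g := I.colCore V) (N := I.nr - 1) (M := I.nc - 1) h1 (by omega) hb hZ
          (fun k _ => h.rowCore_nonneg (by omega) k)
        refine ⟨τ', h3, ?_⟩
        rw [h4, h2, I.sum_rowCore]
        push_cast; ring
    · refine ⟨m, s, by omega, by omega, hs0, ?_, hor.imp_right ?_⟩
      · rw [I.pathLength_concat hπ, hlen, weight, if_neg (by simp)]
        push_cast; ring
      · rintro ⟨τ, h1, h2⟩
        obtain ⟨τ', h3, h4⟩ := exists_traversal_horiz (Z := (V : ℝ) ^ 5) (f := I.rowCore V)
          (g := I.colCore V) (N := I.nr - 1) (M := I.nc - 1) h1 ha (by omega) hZ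
          (fun k _ => h.colCore_nonneg (by omega) k)
        refine ⟨τ', h3, ?_⟩
        rw [h4, h2, I.sum_colCore]
        push_cast; ring
    · have hw : 0 ≤ I.weight (a, b) (a + 1, b + 1) := by
        unfold weight
        split_ifs <;> positivity
      refine ⟨m + 1, s + I.weight (a, b) (a + 1, b + 1), by omega, by omega, by linarith, ?_, ?_⟩
      · rw [I.pathLength_concat hπ, hlen]
        push_cast; ring
      · rcases hor with hor | ⟨τ, h1, h2⟩
        · left; linarith
        · by_cases hrc : I.r.getD a 0 = I.c.getD b 0
          · right
            obtain ⟨τ', h3, h4⟩ := exists_traversal_diag (Z := (V : ℝ) ^ 5) (f := I.rowCore V)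
              (g := I.colCore V) (N := I.nr - 1) (M := I.nc - 1) h1 (by omega) (by omega)
            refine ⟨τ', h3, ?_⟩
            rw [h4, h2, h.sum_abs_of_eq (by omega) hrc]
            push_cast; ring
          · left
            have : I.weight (a, b) (a + 1, b + 1) = √(I.U : ℝ) := by
              rw [weight, if_pos rfl, if_neg hrc]
            linarith

theorem exists_traversal_of_path (I : Intermediary) {V : ℕ} (h : I.Admissible V)
    {π : List (ℕ × ℕ)} (hπ : IsGridPath (I.nr - 1) (I.nc - 1) π)
    (hlt : I.pathLength π < I.U * I.gap + √(I.U : ℝ)) :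
    ∃ τ, IsGridPath (20 * (I.nr - 1) + 7) (20 * (I.nc - 1) + 7) τ ∧
      traversalCost (I.curveP V) (I.curveQ V) τ = I.pathLength π + I.offset V := by
  obtain ⟨m, s, hma, hmb, hs0, hlen, hor⟩ := I.exists_traversal_of_prefix h hπ le_rfl le_rfl
  have hU : (1 : ℝ) ≤ I.U := by exact_mod_cast I.U_pos
  have hsU : √(I.U : ℝ) ≤ I.U := by
    rw [Real.sqrt_le_left (by positivity)]; nlinarith
  have hgap := I.gap_eq
  -- Fewer diagonal edges would leave at least `gap + 1` edges of weight `U ≥ √U`, which is beyond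
  -- the threshold.
  have hm : ((I.nr - 1 : ℕ) : ℤ) + (I.nc - 1 : ℕ) - 2 * m = I.gap ∧
      m = min (I.nr - 1) (I.nc - 1) := by
    by_contra hne
    have h1 : (I.gap : ℤ) + 1 ≤ ((I.nr - 1 : ℕ) : ℤ) + (I.nc - 1 : ℕ) - 2 * m := by omega
    have h2 : (I.gap : ℝ) + 1 ≤ ((I.nr - 1 : ℕ) : ℝ) + (I.nc - 1 : ℕ) - 2 * m := by exact_mod_cast h1
    have := mul_le_mul_of_nonneg_left h2 (by linarith : (0 : ℝ) ≤ I.U)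
    linarith
  obtain ⟨hg, hmin⟩ := hm
  have hg' : ((I.nr - 1 : ℕ) : ℝ) + (I.nc - 1 : ℕ) - 2 * m = I.gap := by exact_mod_cast hg
  rw [hg'] at hlen hor
  rcases hor with hor | ⟨τ, h1, h2⟩
  · linarith
  · refine ⟨τ, h1, ?_⟩
    rw [h2, hlen, offset, ← hmin]
    ring

theorem length_curveP (I : Intermediary) (V : ℝ) : (I.curveP V).length = 20 * (I.nr - 1) + 8 := by
  rw [curveP_eq, length_blockCurve]

theorem length_curveQ (I : Intermediary) (V : ℝ) : (I.curveQ V).length = 20 * (I.nc - 1) + 8 := by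
  rw [curveQ_eq, length_blockCurve]

/-- Each of the two values is bounded by the other only if the latter is below the threshold. This
suffices: if one is below, so is the other, and they coincide. -/
theorem exists_isDTW_curves (I : Intermediary) {V : ℕ} (h : I.Admissible V) :
    ∃ v : ℝ, IsDTW (I.curveP V) (I.curveQ V) v ∧ I.IsAnswer (I.report (v - I.offset V)) := by
  obtain ⟨v, hv⟩ := exists_isLeast_gridPath ((I.curveP V).length - 1) ((I.curveQ V).length - 1)
    (traversalCost (I.curveP V) (I.curveQ V))
  refine ⟨v, hv, ?_⟩
  obtain ⟨L, hL⟩ := exists_isLeast_gridPath (I.nr - 1) (I.nc - 1) I.pathLength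
  refine ⟨L, hL, ?_⟩
  rw [length_curveP, length_curveQ] at hv
  change IsLeast {x | ∃ π, IsGridPath (20 * (I.nr - 1) + 7) (20 * (I.nc - 1) + 7) π ∧
    x = traversalCost (I.curveP V) (I.curveQ V) π} v at hv
  have hlow : v - I.offset V < I.U * I.gap + √(I.U : ℝ) → L ≤ v - I.offset V := by
    intro hlt
    obtain ⟨τ, hτ, rfl⟩ := hv.1
    obtain ⟨π, hπ, hle⟩ := I.exists_path_of_traversal h hτ hlt
    exact (hL.2 ⟨π, hπ, rfl⟩).trans hle
  have hupp : L < I.U * I.gap + √(I.U : ℝ) → v - I.offset V ≤ L := by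
    intro hlt
    obtain ⟨π, hπ, rfl⟩ := hL.1
    obtain ⟨τ, hτ, heq⟩ := I.exists_traversal_of_path h hπ hlt
    have := hv.2 ⟨τ, hτ, rfl⟩
    linarith
  unfold report
  by_cases hlt : L < I.U * I.gap + √(I.U : ℝ)
  · have h1 := hupp hlt
    have h2 := hlow (by linarith)
    rw [le_antisymm h1 h2]
  · rw [if_neg hlt, if_neg]
    intro hlt'
    exact hlt ((hlow hlt').trans_lt hlt')

end Intermediary

/-! ## Programs of the real RAM -/

namespace RealRAM

/-- `Reaches` records arbitrary runs, while correctness proofs exhibit one; determinism identifies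
them. -/
theorem Exec.deterministic {c : Cmd} {σ τ : Mem} {s : ℕ} (h : Exec c σ s τ) :
    ∀ {t : ℕ} {υ : Mem}, Exec c σ t υ → s = t ∧ τ = υ := by
  induction h with
  | skip => intro t υ h'; cases h'; exact ⟨rfl, rfl⟩
  | setNat => intro t υ h'; cases h'; exact ⟨rfl, rfl⟩
  | setReal => intro t υ h'; cases h'; exact ⟨rfl, rfl⟩
  | seq _ _ ih₁ ih₂ =>
    intro t υ h'
    cases h' with
    | seq h₁ h₂ =>
      obtain ⟨rfl, rfl⟩ := ih₁ h₁
      obtain ⟨rfl, rfl⟩ := ih₂ h₂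
      exact ⟨rfl, rfl⟩
  | iteTrue hb _ ih =>
    intro t υ h'
    cases h' with
    | iteTrue _ h₁ => obtain ⟨rfl, rfl⟩ := ih h₁; exact ⟨rfl, rfl⟩
    | iteFalse hb' _ => exact absurd hb hb'
  | iteFalse hb _ ih =>
    intro t υ h'
    cases h' with
    | iteTrue hb' _ => exact absurd hb' hb
    | iteFalse _ h₁ => obtain ⟨rfl, rfl⟩ := ih h₁; exact ⟨rfl, rfl⟩
  | whileTrue hb _ _ ih₁ ih₂ =>
    intro t υ h'
    cases h' with
    | whileTrue _ h₁ h₂ =>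
      obtain ⟨rfl, rfl⟩ := ih₁ h₁
      obtain ⟨rfl, rfl⟩ := ih₂ h₂
      exact ⟨rfl, rfl⟩
    | whileFalse hb' => exact absurd hb hb'
  | whileFalse hb =>
    intro t υ h'
    cases h' with
    | whileTrue hb' _ _ => exact absurd hb' hb
    | whileFalse _ => exact ⟨rfl, rfl⟩

theorem Test.cost_pos (b : Test) : 1 ≤ b.cost := by
  cases b <;> simp [Test.cost]

/-- Lets a constant overhead be absorbed into a multiple of the running time of `D`. -/
theorem Exec.one_le {c : Cmd} {σ τ : Mem} {s : ℕ} (h : Exec c σ s τ) : 1 ≤ s := by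
  induction h with
  | skip => omega
  | setNat => omega
  | setReal => omega
  | seq => omega
  | iteTrue => omega
  | iteFalse => omega
  | whileTrue => omega
  | whileFalse => exact Test.cost_pos _

/-! ### Renaming the arrays of a program -/

/-- Add `K` to all array names. -/
def NatExpr.shift (K : ℕ) : NatExpr → NatExpr
  | .const k => .const k
  | .read a i => .read (a + K) (i.shift K)
  | .plus e f => .plus (e.shift K) (f.shift K)
  | .minus e f => .minus (e.shift K) (f.shift K)
  | .times e f => .times (e.shift K) (f.shift K)
  | .quot e f => .quot (e.shift K) (f.shift K)

/-- Add `K` to all array names. -/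
def RealExpr.shift (K : ℕ) : RealExpr → RealExpr
  | .cast e => .cast (e.shift K)
  | .read a i => .read (a + K) (i.shift K)
  | .plus e f => .plus (e.shift K) (f.shift K)
  | .minus e f => .minus (e.shift K) (f.shift K)
  | .times e f => .times (e.shift K) (f.shift K)
  | .quot e f => .quot (e.shift K) (f.shift K)

/-- Add `K` to all array names. -/
def Test.shift (K : ℕ) : Test → Test
  | .natLt e f => .natLt (e.shift K) (f.shift K)
  | .natEq e f => .natEq (e.shift K) (f.shift K)
  | .realLt e f => .realLt (e.shift K) (f.shift K)
  | .realEq e f => .realEq (e.shift K) (f.shift K)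

/-- Add `K` to all array names. -/
def Cmd.shift (K : ℕ) : Cmd → Cmd
  | .skip => .skip
  | .setNat a i e => .setNat (a + K) (i.shift K) (e.shift K)
  | .setReal a i e => .setReal (a + K) (i.shift K) (e.shift K)
  | .seq c₁ c₂ => .seq (c₁.shift K) (c₂.shift K)
  | .ite t c₁ c₂ => .ite (t.shift K) (c₁.shift K) (c₂.shift K)
  | .while t c => .while (t.shift K) (c.shift K)

/-- The part of the memory that a program with shifted names sees. -/
def Mem.view (K : ℕ) (σ : Mem) : Mem where
  nat a := σ.nat (a + K)
  real a := σ.real (a + K)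

theorem NatExpr.cost_shift (K : ℕ) (e : NatExpr) : (e.shift K).cost = e.cost := by
  induction e <;> simp [NatExpr.shift, NatExpr.cost, *]

theorem RealExpr.cost_shift (K : ℕ) (e : RealExpr) : (e.shift K).cost = e.cost := by
  induction e <;> simp [RealExpr.shift, RealExpr.cost, NatExpr.cost_shift, *]

theorem Test.cost_shift (K : ℕ) (t : Test) : (t.shift K).cost = t.cost := by
  cases t <;> simp [Test.shift, Test.cost, NatExpr.cost_shift, RealExpr.cost_shift]

theorem NatExpr.eval_shift (K : ℕ) (σ : Mem) (e : NatExpr) :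
    (e.shift K).eval σ = e.eval (σ.view K) := by
  induction e <;> simp [NatExpr.shift, NatExpr.eval, Mem.view, *]

theorem RealExpr.eval_shift (K : ℕ) (σ : Mem) (e : RealExpr) :
    (e.shift K).eval σ = e.eval (σ.view K) := by
  induction e <;> simp_all [RealExpr.shift, RealExpr.eval, NatExpr.eval_shift, Mem.view]

theorem Test.holds_shift (K : ℕ) (σ : Mem) (t : Test) :
    (t.shift K).Holds σ ↔ t.Holds (σ.view K) := by
  cases t <;> simp [Test.shift, Test.Holds, NatExpr.eval_shift, RealExpr.eval_shift]

theorem Mem.nat_setNat (σ : Mem) (a i v b j : ℕ) :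
    (σ.setNat a i v).nat b j = if b = a ∧ j = i then v else σ.nat b j := by
  by_cases h : b = a
  · subst h
    by_cases h' : j = i
    · subst h'; simp [Mem.setNat]
    · simp [Mem.setNat, h']
  · simp [Mem.setNat, h]

theorem Mem.real_setReal (σ : Mem) (a i : ℕ) (v : ℝ) (b j : ℕ) :
    (σ.setReal a i v).real b j = if b = a ∧ j = i then v else σ.real b j := by
  by_cases h : b = a
  · subst h
    by_cases h' : j = i
    · subst h'; simp [Mem.setReal]
    · simp [Mem.setReal, h']
  · simp [Mem.setReal, h]

theorem Mem.real_setNat (σ : Mem) (a i v : ℕ) : (σ.setNat a i v).real = σ.real := rfl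

theorem Mem.nat_setReal (σ : Mem) (a i : ℕ) (v : ℝ) : (σ.setReal a i v).nat = σ.nat := rfl

theorem Mem.ext_cells {σ τ : Mem} (h₁ : ∀ a i, σ.nat a i = τ.nat a i)
    (h₂ : ∀ a i, σ.real a i = τ.real a i) : σ = τ := by
  cases σ
  cases τ
  congr
  · exact funext fun a => funext fun i => h₁ a i
  · exact funext fun a => funext fun i => h₂ a i

theorem Mem.view_setNat (K : ℕ) (σ : Mem) (a i v : ℕ) :
    (σ.setNat (a + K) i v).view K = (σ.view K).setNat a i v := by
  refine Mem.ext_cells (fun b j => ?_) fun b j => rfl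
  rw [Mem.nat_setNat]
  simp [Mem.view, Mem.nat_setNat]

theorem Mem.view_setReal (K : ℕ) (σ : Mem) (a i : ℕ) (v : ℝ) :
    (σ.setReal (a + K) i v).view K = (σ.view K).setReal a i v := by
  refine Mem.ext_cells (fun b j => rfl) fun b j => ?_
  rw [Mem.real_setReal]
  simp [Mem.view, Mem.real_setReal]

theorem Mem.view_setNat_of_lt {K a : ℕ} (h : a < K) (σ : Mem) (i v : ℕ) :
    (σ.setNat a i v).view K = σ.view K := by
  refine Mem.ext_cells (fun b j => ?_) fun b j => rfl
  simp only [Mem.view, Mem.nat_setNat]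
  rw [if_neg (by omega)]

theorem Mem.view_setReal_of_lt {K a : ℕ} (h : a < K) (σ : Mem) (i : ℕ) (v : ℝ) :
    (σ.setReal a i v).view K = σ.view K := by
  refine Mem.ext_cells (fun b j => rfl) fun b j => ?_
  simp only [Mem.view, Mem.real_setReal]
  rw [if_neg (by omega)]

/-- A program with shifted names simulates the original one and leaves the first `K` arrays
alone. -/
theorem Exec.shift {c : Cmd} {σ τ : Mem} {t : ℕ} (h : Exec c σ t τ) (K : ℕ) :
    ∀ σ' : Mem, σ'.view K = σ → ∃ τ', Exec (c.shift K) σ' t τ' ∧ τ'.view K = τ ∧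
      ∀ a < K, τ'.nat a = σ'.nat a := by
  induction h with
  | skip σ => intro σ' h; exact ⟨σ', .skip _, h, fun _ _ => rfl⟩
  | setNat σ a i e =>
    rintro σ' rfl
    refine ⟨_, ?_, Mem.view_setNat K σ' a _ _, fun b hb => ?_⟩
    · have := Exec.setNat σ' (a + K) (i.shift K) (e.shift K)
      rwa [NatExpr.cost_shift, NatExpr.cost_shift, NatExpr.eval_shift, NatExpr.eval_shift] at this
    · funext j
      rw [Mem.nat_setNat, if_neg (by omega)]
  | setReal σ a i e =>
    rintro σ' rfl
    refine ⟨_, ?_, Mem.view_setReal K σ' a _ _, fun b hb => rfl⟩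
    have := Exec.setReal σ' (a + K) (i.shift K) (e.shift K)
    rwa [NatExpr.cost_shift, RealExpr.cost_shift, NatExpr.eval_shift, RealExpr.eval_shift] at this
  | seq _ _ ih₁ ih₂ =>
    intro σ' h
    obtain ⟨τ', h1, h2, h3⟩ := ih₁ σ' h
    obtain ⟨υ', h4, h5, h6⟩ := ih₂ τ' h2
    exact ⟨υ', h1.seq h4, h5, fun a ha => (h6 a ha).trans (h3 a ha)⟩
  | iteTrue hb _ ih =>
    rintro σ' rfl
    obtain ⟨τ', h1, h2, h3⟩ := ih σ' rfl
    refine ⟨τ', ?_, h2, h3⟩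
    rw [← Test.cost_shift K]
    exact .iteTrue ((Test.holds_shift _ _ _).2 hb) h1
  | iteFalse hb _ ih =>
    rintro σ' rfl
    obtain ⟨τ', h1, h2, h3⟩ := ih σ' rfl
    refine ⟨τ', ?_, h2, h3⟩
    rw [← Test.cost_shift K]
    exact .iteFalse (fun h => hb ((Test.holds_shift _ _ _).1 h)) h1
  | whileTrue hb _ _ ih₁ ih₂ =>
    rintro σ' rfl
    obtain ⟨τ', h1, h2, h3⟩ := ih₁ σ' rfl
    obtain ⟨υ', h4, h5, h6⟩ := ih₂ τ' h2
    refine ⟨υ', ?_, h5, fun a ha => (h6 a ha).trans (h3 a ha)⟩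
    rw [← Test.cost_shift K]
    exact .whileTrue ((Test.holds_shift _ _ _).2 hb) h1 h4
  | whileFalse hb =>
    rintro σ' rfl
    refine ⟨σ', ?_, rfl, fun _ _ => rfl⟩
    rw [← Test.cost_shift K]
    exact .whileFalse fun h => hb ((Test.holds_shift _ _ _).1 h)

/-! ### Total correctness with time bounds -/

/-- Started in `σ`, the command `c` halts within `t` steps in a memory that satisfies `Q`. -/
def Runs (c : Cmd) (σ : Mem) (t : ℕ) (Q : Mem → Prop) : Prop :=
  ∃ s τ, Exec c σ s τ ∧ s ≤ t ∧ Q τ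

namespace Runs

variable {c c₁ c₂ : Cmd} {σ : Mem} {s t u : ℕ} {Q R : Mem → Prop}

theorem mono (h : Runs c σ s R) (hst : s ≤ t) (hRQ : ∀ τ, R τ → Q τ) : Runs c σ t Q := by
  obtain ⟨s', τ, h1, h2, h3⟩ := h
  exact ⟨s', τ, h1, h2.trans hst, hRQ τ h3⟩

theorem of_exec (h : Runs c σ t Q) {s : ℕ} {τ : Mem} (he : Exec c σ s τ) : Q τ := by
  obtain ⟨s', τ', h1, _, h3⟩ := h
  obtain ⟨-, rfl⟩ := h1.deterministic he
  exact h3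

theorem setNat {a : ℕ} {i e : NatExpr} (ht : i.cost + e.cost + 1 ≤ t)
    (hQ : Q (σ.setNat a (i.eval σ) (e.eval σ))) : Runs (.setNat a i e) σ t Q :=
  ⟨_, _, .setNat σ a i e, ht, hQ⟩

theorem setReal {a : ℕ} {i : NatExpr} {e : RealExpr} (ht : i.cost + e.cost + 1 ≤ t)
    (hQ : Q (σ.setReal a (i.eval σ) (e.eval σ))) : Runs (.setReal a i e) σ t Q :=
  ⟨_, _, .setReal σ a i e, ht, hQ⟩

theorem seq (h₁ : Runs c₁ σ s R) (h₂ : ∀ τ, R τ → Runs c₂ τ t Q) (hu : s + t ≤ u) :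
    Runs (.seq c₁ c₂) σ u Q := by
  obtain ⟨s', τ, h1, h2, h3⟩ := h₁
  obtain ⟨t', υ, h4, h5, h6⟩ := h₂ τ h3
  exact ⟨_, υ, h1.seq h4, by omega, h6⟩

theorem ite {b : Test} (h₁ : b.Holds σ → Runs c₁ σ t Q) (h₂ : ¬ b.Holds σ → Runs c₂ σ t Q)
    (hu : b.cost + t ≤ u) : Runs (.ite b c₁ c₂) σ u Q := by
  by_cases hb : b.Holds σ
  · obtain ⟨t', υ, h4, h5, h6⟩ := h₁ hb
    exact ⟨_, υ, .iteTrue hb h4, by omega, h6⟩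
  · obtain ⟨t', υ, h4, h5, h6⟩ := h₂ hb
    exact ⟨_, υ, .iteFalse hb h4, by omega, h6⟩

end Runs

/-! ### Loops and the evaluation of block curves -/

/-- The integer expression that reads a fixed cell. -/
abbrev cell (a k : ℕ) : NatExpr := .read a (.const k)

/-- `for i := 0, …, bound - 1 do body`, with the counter in cell `1` of integer array `7`. -/
def forLoop (bound : NatExpr) (body : Cmd) : Cmd :=
  .seq (.setNat 7 (.const 1) (.const 0))
    (.while (.natLt (cell 7 1) bound)
      (.seq body (.setNat 7 (.const 1) (.plus (cell 7 1) (.const 1)))))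

/-- `Inv i` describes the memory before iteration `i`, counter included; the body must not move the
counter. The overhead `bound.cost + 9` pays for one test and one increment. -/
theorem Runs.forLoop {bound : NatExpr} {body : Cmd} {σ : Mem} {Q : Mem → Prop} {n B u : ℕ}
    (Inv : ℕ → Mem → Prop) (hinv : ∀ i σ, Inv i σ → σ.nat 7 1 = i ∧ bound.eval σ = n)
    (hinit : Inv 0 (σ.setNat 7 1 0))
    (hstep : ∀ i < n, ∀ σ, Inv i σ →
      Runs body σ B fun τ => τ.nat 7 1 = i ∧ Inv (i + 1) (τ.setNat 7 1 (i + 1)))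
    (hpost : ∀ σ, Inv n σ → Q σ) (hu : n * (B + bound.cost + 9) + bound.cost + 6 ≤ u) :
    Runs (RealRAM.forLoop bound body) σ u Q := by
  have key : ∀ k i σ, i + k = n → Inv i σ →
      Runs (.while (.natLt (cell 7 1) bound)
        (.seq body (.setNat 7 (.const 1) (.plus (cell 7 1) (.const 1))))) σ
        (k * (B + bound.cost + 9) + bound.cost + 3) Q := by
    intro k
    induction k with
    | zero =>
      intro i σ hik hI
      obtain ⟨h1, h2⟩ := hinv i σ hI
      obtain rfl : i = n := by omega
      refine ⟨_, σ, .whileFalse ?_, ?_, hpost σ hI⟩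
      · simp [Test.Holds, NatExpr.eval, h1, h2]
      · simp [Test.cost, NatExpr.cost]; omega
    | succ k ih =>
      intro i σ hik hI
      obtain ⟨h1, h2⟩ := hinv i σ hI
      obtain ⟨s, τ, e1, e2, e3, e4⟩ := hstep i (by omega) σ hI
      obtain ⟨s', υ, e5, e6, e7⟩ := ih (i + 1) _ (by omega) e4
      have e8 := Exec.setNat τ 7 (.const 1) (.plus (cell 7 1) (.const 1))
      simp only [NatExpr.eval, e3] at e8
      refine ⟨_, υ, .whileTrue ?_ (e1.seq e8) e5, ?_, e7⟩
      · simp only [Test.Holds, NatExpr.eval, h1, h2]; omega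
      · simp only [Test.cost, NatExpr.cost]
        rw [Nat.succ_mul]
        omega
  exact Runs.seq (R := Inv 0) (s := 3) (Runs.setNat (by simp [NatExpr.cost]) hinit)
    (fun τ hτ => key n 0 τ (by omega) hτ) (by omega)

/-- Sum the values of `e` over a range into cell `k` of integer array `7`. -/
def sumLoop (k : ℕ) (bound e : NatExpr) : Cmd :=
  forLoop bound (.setNat 7 (.const k) (.plus (cell 7 k) e))

/-- Only array `7` is written, so `bound` and `e` are specified on all memories that agree with `σ`
elsewhere. -/
theorem runs_sumLoop {k : ℕ} {bound e : NatExpr} {σ : Mem} {n u : ℕ} (h : ℕ → ℕ) (hk : k ≠ 1)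
    (h0 : σ.nat 7 k = 0)
    (hbound : ∀ τ : Mem, (∀ a i, a ≠ 7 → τ.nat a i = σ.nat a i) → bound.eval τ = n)
    (he : ∀ τ : Mem, (∀ a i, a ≠ 7 → τ.nat a i = σ.nat a i) → e.eval τ = h (τ.nat 7 1))
    (hu : n * (e.cost + bound.cost + 14) + bound.cost + 6 ≤ u) :
    Runs (sumLoop k bound e) σ u fun τ => τ.real = σ.real ∧
      τ.nat 7 k = ∑ i ∈ Finset.range n, h i ∧
      ∀ a i, ¬ (a = 7 ∧ (i = 1 ∨ i = k)) → τ.nat a i = σ.nat a i := by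
  refine Runs.forLoop (n := n) (B := e.cost + 5) (fun j τ => τ.nat 7 1 = j ∧ τ.real = σ.real ∧
    τ.nat 7 k = ∑ i ∈ Finset.range j, h i ∧
      ∀ a i, ¬ (a = 7 ∧ (i = 1 ∨ i = k)) → τ.nat a i = σ.nat a i) ?_ ?_ ?_ ?_ ?_
  · rintro j τ ⟨h1, -, -, h2⟩
    exact ⟨h1, hbound τ fun a i ha => h2 a i (by tauto)⟩
  · refine ⟨by simp [Mem.nat_setNat], rfl, by simp [Mem.nat_setNat, hk, h0], fun a i ha => ?_⟩
    rw [Mem.nat_setNat, if_neg (by tauto)]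
  · rintro j hj τ ⟨h1, h2, h3, h4⟩
    have hev := he τ fun a i ha => h4 a i (by tauto)
    refine Runs.setNat (by simp only [NatExpr.cost]; omega) ?_
    simp only [NatExpr.eval, hev, h1, h3]
    refine ⟨?_, ?_, h2, ?_, fun a i ha => ?_⟩
    · simp [Mem.nat_setNat, hk.symm, h1]
    · simp [Mem.nat_setNat]
    · simp [Mem.nat_setNat, hk, Finset.sum_range_succ]
    · rw [Mem.nat_setNat, if_neg (by tauto), Mem.nat_setNat, if_neg (by tauto), h4 a i ha]
  · rintro τ ⟨-, h2, h3, h4⟩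
    exact ⟨h2, h3, h4⟩
  · rw [show e.cost + 5 + bound.cost + 9 = e.cost + bound.cost + 14 by ring]
    exact hu

/-- The `k`-th power of cell `0` of integer array `7`. -/
def paramPow : ℕ → NatExpr
  | 0 => .const 1
  | k + 1 => .times (paramPow k) (cell 7 0)

theorem eval_paramPow (σ : Mem) (k : ℕ) : (paramPow k).eval σ = σ.nat 7 0 ^ k := by
  induction k with
  | zero => rfl
  | succ k ih => simp [paramPow, NatExpr.eval, ih, pow_succ]

/-- The index in cell `1` of integer array `7` modulo `20`. -/
def idxMod : NatExpr := .minus (cell 7 1) (.times (.const 20) (.quot (cell 7 1) (.const 20)))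

/-- The index in cell `1` of integer array `7` divided by `20`. -/
def idxDiv : NatExpr := .quot (cell 7 1) (.const 20)

theorem eval_idxMod (σ : Mem) : idxMod.eval σ = σ.nat 7 1 % 20 := by
  simp only [idxMod, NatExpr.eval]
  omega

/-- Fill real array `a` with a block curve whose core vertices are given by expressions. -/
def fillLoop (a : ℕ) (bound : NatExpr) (e₀ e₁ e₂ e₃ : RealExpr) : Cmd :=
  forLoop bound
    (.ite (.natLt idxMod (.const 16))
      (.setReal a (cell 7 1) (.minus (.cast (.const 0)) (.cast (paramPow 5))))
      (.ite (.natEq idxMod (.const 16)) (.setReal a (cell 7 1) e₀)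
        (.ite (.natEq idxMod (.const 17)) (.setReal a (cell 7 1) e₁)
          (.ite (.natEq idxMod (.const 18)) (.setReal a (cell 7 1) e₂)
            (.setReal a (cell 7 1) e₃)))))

theorem runs_fillLoop {a : ℕ} {bound : NatExpr} {e₀ e₁ e₂ e₃ : RealExpr} {σ : Mem} {n u V : ℕ}
    (f : ℕ → ℕ → ℝ) (hV : σ.nat 7 0 = V)
    (hbound : ∀ τ : Mem, (∀ a i, ¬ (a = 7 ∧ i = 1) → τ.nat a i = σ.nat a i) → bound.eval τ = n)
    (he : ∀ τ : Mem, (∀ a i, ¬ (a = 7 ∧ i = 1) → τ.nat a i = σ.nat a i) →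
      e₀.eval τ = f (τ.nat 7 1 / 20) 0 ∧ e₁.eval τ = f (τ.nat 7 1 / 20) 1 ∧
      e₂.eval τ = f (τ.nat 7 1 / 20) 2 ∧ e₃.eval τ = f (τ.nat 7 1 / 20) 3)
    (hcost : e₀.cost ≤ 60 ∧ e₁.cost ≤ 60 ∧ e₂.cost ≤ 60 ∧ e₃.cost ≤ 60)
    (hu : n * (bound.cost + 129) + bound.cost + 6 ≤ u) :
    Runs (fillLoop a bound e₀ e₁ e₂ e₃) σ u fun τ =>
      (∀ b i, τ.real b i = if b = a ∧ i < n then blockVal ((V : ℝ) ^ 5) f i else σ.real b i) ∧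
      ∀ b i, ¬ (b = 7 ∧ i = 1) → τ.nat b i = σ.nat b i := by
  refine Runs.forLoop (n := n) (B := 120) (fun j τ => τ.nat 7 1 = j ∧
    (∀ b i, τ.real b i = if b = a ∧ i < j then blockVal ((V : ℝ) ^ 5) f i else σ.real b i) ∧
      ∀ b i, ¬ (b = 7 ∧ i = 1) → τ.nat b i = σ.nat b i) ?_ ?_ ?_ ?_ ?_
  · rintro j τ ⟨h1, -, h2⟩
    exact ⟨h1, hbound τ h2⟩
  · refine ⟨by simp [Mem.nat_setNat], fun b i => by simp [Mem.real_setNat], fun b i hb => ?_⟩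
    rw [Mem.nat_setNat, if_neg hb]
  · rintro j hj τ ⟨h1, h2, h3⟩
    obtain ⟨v0, v1, v2, v3⟩ := he τ h3
    obtain ⟨c0, c1, c2, c3⟩ := hcost
    have hV' : τ.nat 7 0 = V := by rw [h3 7 0 (by omega), hV]
    have hmod : idxMod.eval τ = j % 20 := by rw [eval_idxMod, h1]
    have hmodc : idxMod.cost = 9 := rfl
    rw [h1] at v0 v1 v2 v3
    -- The common end of all five branches: storing the right value restores the invariant.
    have hset : ∀ v : ℝ, v = blockVal ((V : ℝ) ^ 5) f j →
        (τ.setReal a ((cell 7 1).eval τ) v).nat 7 1 = j ∧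
        (((τ.setReal a ((cell 7 1).eval τ) v).setNat 7 1 (j + 1)).nat 7 1 = j + 1 ∧
        (∀ b i, ((τ.setReal a ((cell 7 1).eval τ) v).setNat 7 1 (j + 1)).real b i =
          if b = a ∧ i < j + 1 then blockVal ((V : ℝ) ^ 5) f i else σ.real b i) ∧
        ∀ b i, ¬ (b = 7 ∧ i = 1) →
          ((τ.setReal a ((cell 7 1).eval τ) v).setNat 7 1 (j + 1)).nat b i = σ.nat b i) := by
      rintro v rfl
      simp only [NatExpr.eval, h1]
      refine ⟨h1, by simp [Mem.nat_setNat], fun b i => ?_, fun b i hb => ?_⟩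
      · rw [Mem.real_setNat, Mem.real_setReal, h2]
        by_cases hb : b = a
        · by_cases hi : i = j
          · subst hi; simp [hb]
          · have : i < j + 1 ↔ i < j := by omega
            simp [hb, hi, this]
        · simp [hb]
      · rw [Mem.nat_setNat, if_neg hb, Mem.nat_setReal, h3 b i hb]
    have hlt : j % 20 < 20 := Nat.mod_lt _ (by norm_num)
    refine Runs.ite (t := 109) (fun hb => ?_) (fun hb => ?_)
      (by simp only [Test.cost, NatExpr.cost, hmodc]; omega)
    · simp only [Test.Holds, hmod, NatExpr.eval] at hb
      refine Runs.setReal (by simp [NatExpr.cost, RealExpr.cost, paramPow]) (hset _ ?_)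
      rw [blockVal_star hb]
      simp [RealExpr.eval, NatExpr.eval, eval_paramPow, hV']
    simp only [Test.Holds, hmod, NatExpr.eval] at hb
    have hcore : blockVal ((V : ℝ) ^ 5) f j = f (j / 20) (j % 20 - 16) :=
      blockVal_core (by omega)
    refine Runs.ite (t := 98) (fun hb1 => ?_) (fun hb1 => ?_)
      (by simp only [Test.cost, NatExpr.cost, hmodc]; omega)
    · simp only [Test.Holds, hmod, NatExpr.eval] at hb1
      refine Runs.setReal (by simp only [NatExpr.cost]; omega) (hset _ ?_)
      rw [hcore, v0, hb1]
    simp only [Test.Holds, hmod, NatExpr.eval] at hb1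
    refine Runs.ite (t := 87) (fun hb2 => ?_) (fun hb2 => ?_)
      (by simp only [Test.cost, NatExpr.cost, hmodc]; omega)
    · simp only [Test.Holds, hmod, NatExpr.eval] at hb2
      refine Runs.setReal (by simp only [NatExpr.cost]; omega) (hset _ ?_)
      rw [hcore, v1, hb2]
    simp only [Test.Holds, hmod, NatExpr.eval] at hb2
    refine Runs.ite (t := 76) (fun hb3 => ?_) (fun hb3 => ?_)
      (by simp only [Test.cost, NatExpr.cost, hmodc]; omega)
    · simp only [Test.Holds, hmod, NatExpr.eval] at hb3
      refine Runs.setReal (by simp only [NatExpr.cost]; omega) (hset _ ?_)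
      rw [hcore, v2, hb3]
    · simp only [Test.Holds, hmod, NatExpr.eval] at hb3
      refine Runs.setReal (by simp only [NatExpr.cost]; omega) (hset _ ?_)
      rw [hcore, v3, show j % 20 - 16 = 3 by omega]
  · rintro τ ⟨-, h2, h3⟩
    exact ⟨h2, h3⟩
  · refine le_trans (le_of_eq ?_) hu
    ring

end RealRAM

/-! ## The data structure for Intermediary -/

open RealRAM

namespace Intermediary

/-! ### The parameter of the gadget curves -/

/-- The value of the parameter `V` that the data structure uses. -/
def param (I : Intermediary) : ℕ :=
  I.U + I.nr * I.nc * ((1 + ∑ i ∈ Finset.range I.nr, (I.r.getD i 0 + I.d.getD i 0)) *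
    (1 + ∑ i ∈ Finset.range I.nr, (I.r.getD i 0 + I.d.getD i 0)) *
    (1 + ∑ j ∈ Finset.range I.nc, I.c.getD j 0)) *
    ((1 + ∑ i ∈ Finset.range I.nr, (I.r.getD i 0 + I.d.getD i 0)) *
    (1 + ∑ i ∈ Finset.range I.nr, (I.r.getD i 0 + I.d.getD i 0)) *
    (1 + ∑ j ∈ Finset.range I.nc, I.c.getD j 0)) + 1

theorem _root_.listMax_le_sum (l : List ℕ) :
    listMax l ≤ ∑ i ∈ Finset.range l.length, l.getD i 0 := by
  induction l with
  | nil => simp [listMax]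
  | cons x l ih =>
    rw [List.length_cons, Finset.sum_range_succ']
    simp only [listMax, List.foldr_cons, List.getD_cons_succ, List.getD_cons_zero] at ih ⊢
    omega

/-- Sums dominate maxima, and the joint sum of `r` and `d` serves for both. -/
theorem admissible_param (I : Intermediary) : I.Admissible I.param := by
  have hr := listMax_le_sum I.r
  have hd := listMax_le_sum I.d
  have hc := listMax_le_sum I.c
  rw [I.d_length] at hd
  have hs : ∑ i ∈ Finset.range I.nr, (I.r.getD i 0 + I.d.getD i 0) =
    ∑ i ∈ Finset.range I.r.length, I.r.getD i 0 + ∑ i ∈ Finset.range I.r.length, I.d.getD i 0 :=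
    Finset.sum_add_distrib
  constructor
  · unfold param
    rw [add_assoc]
    exact Nat.le_add_right _ _
  · unfold param
    rw [hs]
    unfold nc
    generalize ∑ i ∈ Finset.range I.r.length, I.r.getD i 0 = A at *
    generalize ∑ i ∈ Finset.range I.r.length, I.d.getD i 0 = B at *
    generalize ∑ j ∈ Finset.range I.c.length, I.c.getD j 0 = D at *
    have h1 : max 1 (listMax I.d) ≤ 1 + (A + B) := by omega
    have h2 : max 1 (listMax I.r) ≤ 1 + (A + B) := by omega
    have h3 : max 1 (listMax I.c) ≤ 1 + D := by omega
    have h4 := Nat.mul_le_mul_left (I.nr * I.c.length)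
      (Nat.pow_le_pow_left (Nat.mul_le_mul (Nat.mul_le_mul h1 h2) h3) 2)
    rw [pow_two ((1 + (A + B)) * (1 + (A + B)) * (1 + D)), ← mul_assoc] at h4
    omega

/-- The gadget curves as an input of dynamic DTW. -/
noncomputable def curves (I : Intermediary) : CurvePair where
  P := I.curveP I.param
  Q := I.curveQ I.param
  P_ne := by simp [curveP, stars]
  Q_ne := by simp [curveQ, stars]

theorem length_curves_P (I : Intermediary) : I.curves.P.length = 20 * (I.nr - 1) + 8 :=
  I.length_curveP _

theorem length_curves_Q (I : Intermediary) : I.curves.Q.length = 20 * (I.nc - 1) + 8 :=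
  I.length_curveQ _

theorem _root_.CurvePair.ext {s t : CurvePair} (hP : s.P = t.P) (hQ : s.Q = t.Q) : s = t := by
  cases s
  cases t
  congr

theorem getD_curves_P (I : Intermediary) (x : ℕ) : I.curves.P.getD x 0 =
    if x < 20 * (I.nr - 1) + 8 then blockVal ((I.param : ℝ) ^ 5) (I.rowCore I.param) x else 0 := by
  split_ifs with h
  · rw [← getD_blockCurve _ _ _ h, ← curveP_eq]; rfl
  · exact List.getD_eq_default _ _ (by rw [length_curves_P]; omega)

theorem getD_curves_Q (I : Intermediary) (x : ℕ) : I.curves.Q.getD x 0 =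
    if x < 20 * (I.nc - 1) + 8 then blockVal ((I.param : ℝ) ^ 5) (I.colCore I.param) x else 0 := by
  split_ifs with h
  · rw [← getD_blockCurve _ _ _ h, ← curveQ_eq]; rfl
  · exact List.getD_eq_default _ _ (by rw [length_curves_Q]; omega)

theorem _root_.List.ext_getD_zero {l m : List ℝ} (hl : l.length = m.length)
    (h : ∀ i < l.length, l.getD i 0 = m.getD i 0) : l = m := by
  refine List.ext_getElem hl fun i h1 h2 => ?_
  have := h i h1
  rwa [List.getD_eq_getElem _ _ h1, List.getD_eq_getElem _ _ h2] at this

theorem _root_.List.getD_set_zero (l : List ℝ) (k : ℕ) (v : ℝ) {i : ℕ} (h : i < l.length) :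
    (l.set k v).getD i 0 = if k = i then v else l.getD i 0 := by
  rw [List.getD_eq_getElem _ _ (by simpa using h), List.getElem_set, List.getD_eq_getElem _ _ h]

/-- Two substitutions in `Q` realize an update. -/
theorem set_set_curves_Q (I : Intermediary) (j : ℕ) (x : Bool) (hj : j < I.nc - 1) :
    ((I.curves.Q.set (20 * j + 18) (colVal I.param (I.c.getD j 0) x 2)).set (20 * j + 19)
      (colVal I.param (I.c.getD j 0) x 3)) = (I.setB j x).curves.Q := by
  have hl : (I.setB j x).curves.Q.length = 20 * (I.nc - 1) + 8 := (I.setB j x).length_curves_Q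
  refine List.ext_getD_zero (by rw [List.length_set, List.length_set, hl, length_curves_Q]) ?_
  intro i hi
  rw [List.length_set, List.length_set] at hi
  rw [List.getD_set_zero _ _ _ (by simpa using hi), List.getD_set_zero _ _ _ hi,
    getD_curves_Q, getD_curves_Q]
  rw [length_curves_Q] at hi
  rw [if_pos hi, if_pos (show i < 20 * ((I.setB j x).nc - 1) + 8 from hi)]
  -- `param` ignores the Booleans, so the parameter survives the update.
  change _ = blockVal ((I.param : ℝ) ^ 5) ((I.setB j x).colCore I.param) i
  have hbl : j < I.b.length := by
    have := I.b_length
    unfold nc at hj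
    omega
  have hb : (I.b.set j x).getD j false = x := by
    rw [List.getD_eq_getElem _ _ (by simpa using hbl), List.getElem_set_self]
  split_ifs with h1 h2
  · subst h1
    rw [show 20 * j + 19 = 20 * j + 16 + 3 by ring, blockVal_core' (by norm_num)]
    simp only [colCore, setB, hb]
  · subst h2
    rw [show 20 * j + 18 = 20 * j + 16 + 2 by ring, blockVal_core' (by norm_num)]
    simp only [colCore, setB, hb]
  · unfold blockVal
    split_ifs with h3
    · rfl
    · simp only [colCore, setB]
      by_cases h4 : i / 20 = j
      -- In column `j` only the first two core vertices remain, and they do not involve the Boolean.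
      · have : i % 20 - 16 = 0 ∨ i % 20 - 16 = 1 := by omega
        rcases this with h | h <;> simp [colVal, h]
      · congr 1
        simp only [List.getD_eq_getElem?_getD]
        rw [List.getElem?_set_ne (fun h => h4 h.symm)]

/-- The substitutions are variables with prescribed components because the type of `u₂` depends on
the curve that `u₁` produces. -/
theorem apply_apply_curves (I : Intermediary) (j : ℕ) (x : Bool) (hj : j < I.nc - 1) (u₁ u₂)
    (h₁ : u₁.1.1 = 20 * j + 18) (h₁' : u₁.2 = colVal I.param (I.c.getD j 0) x 2)
    (h₂ : u₂.1.1 = 20 * j + 19) (h₂' : u₂.2 = colVal I.param (I.c.getD j 0) x 3) :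
    dynamicDTW.apply (dynamicDTW.apply I.curves u₁) u₂ = (I.setB j x).curves := by
  refine CurvePair.ext rfl ?_
  rw [← I.set_set_curves_Q j x hj, ← h₁, ← h₁', ← h₂, ← h₂']
  rfl

/-! ### Expressions for the core vertices -/

/-- The third and fourth vertex of a column gadget have the sign `(-1) ^ b = 1 - 2 b`. -/
def signExpr (b : NatExpr) : RealExpr := .minus (.cast (.const 1)) (.cast (.times (.const 2) b))

/-- `k V ^ 4` -/
def quartic (k : ℕ) : NatExpr := .times (.const k) (paramPow 4)

/-- `2 c V ^ 3` -/
def cubic (c : NatExpr) : NatExpr := .times (.times (.const 2) c) (paramPow 3)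

/-- The first core vertex of a column gadget. -/
def colExpr₀ (c : NatExpr) : RealExpr :=
  .minus (.plus (.cast (quartic 1)) (.cast (cubic c))) (.cast (cell 7 0))

/-- The second core vertex of a column gadget. -/
def colExpr₁ (c : NatExpr) : RealExpr :=
  .plus (.plus (.cast (quartic 2)) (.cast (cubic c))) (.cast (cell 7 0))

/-- The third core vertex of a column gadget. -/
def colExpr₂ (c b : NatExpr) : RealExpr :=
  .plus (.minus (.cast (quartic 3)) (.cast (cubic c))) (.times (signExpr b) (.cast (cell 7 0)))

/-- The fourth core vertex of a column gadget. -/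
def colExpr₃ (c b : NatExpr) : RealExpr :=
  .minus (.minus (.cast (quartic 4)) (.cast (cubic c))) (.times (signExpr b) (.cast (cell 7 0)))

/-- `d / 4` -/
def quarter (d : NatExpr) : RealExpr := .quot (.cast d) (.cast (.const 4))

/-- The first core vertex of a row gadget. -/
def rowExpr₀ (r d : NatExpr) : RealExpr :=
  .plus (.plus (.cast (quartic 1)) (.cast (cubic r))) (quarter d)

/-- The second core vertex of a row gadget. -/
def rowExpr₁ (r d : NatExpr) : RealExpr :=
  .minus (.plus (.cast (quartic 2)) (.cast (cubic r))) (quarter d)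

/-- The third core vertex of a row gadget. -/
def rowExpr₂ (r d : NatExpr) : RealExpr :=
  .plus (.minus (.cast (quartic 3)) (.cast (cubic r))) (quarter d)

/-- The fourth core vertex of a row gadget. -/
def rowExpr₃ (r d : NatExpr) : RealExpr :=
  .minus (.minus (.cast (quartic 4)) (.cast (cubic r))) (quarter d)

theorem eval_signExpr {σ : Mem} {b : NatExpr} {x : Bool} (hb : b.eval σ = x.toNat) :
    (signExpr b).eval σ = (-1) ^ x.toNat := by
  cases x <;> simp [signExpr, RealExpr.eval, NatExpr.eval, hb]; norm_num

theorem eval_colExpr {σ : Mem} {c b : NatExpr} {V k : ℕ} {x : Bool} (hV : σ.nat 7 0 = V)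
    (hc : c.eval σ = k) (hb : b.eval σ = x.toNat) :
    (colExpr₀ c).eval σ = colVal V k x 0 ∧ (colExpr₁ c).eval σ = colVal V k x 1 ∧
    (colExpr₂ c b).eval σ = colVal V k x 2 ∧ (colExpr₃ c b).eval σ = colVal V k x 3 := by
  simp only [colExpr₀, colExpr₁, colExpr₂, colExpr₃, RealExpr.eval, eval_signExpr hb, quartic,
    cubic, NatExpr.eval, eval_paramPow, hV, hc, colVal]
  norm_num

theorem eval_rowExpr {σ : Mem} {r d : NatExpr} {V k l : ℕ} (hV : σ.nat 7 0 = V)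
    (hr : r.eval σ = k) (hd : d.eval σ = l) :
    (rowExpr₀ r d).eval σ = rowVal V k l 0 ∧ (rowExpr₁ r d).eval σ = rowVal V k l 1 ∧
    (rowExpr₂ r d).eval σ = rowVal V k l 2 ∧ (rowExpr₃ r d).eval σ = rowVal V k l 3 := by
  simp only [rowExpr₀, rowExpr₁, rowExpr₂, rowExpr₃, RealExpr.eval, quarter, quartic,
    cubic, NatExpr.eval, eval_paramPow, hV, hr, hd, rowVal]
  norm_num

/-! ### The three programs -/

/-- The value of the parameter from the sums in cells `2` and `3` of integer array `7`. -/
def paramExpr : NatExpr :=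
  .plus (.plus (cell 0 2)
    (.times (.times (.times (cell 0 0) (cell 0 1))
      (.times (.times (.plus (.const 1) (cell 7 2)) (.plus (.const 1) (cell 7 2)))
        (.plus (.const 1) (cell 7 3))))
      (.times (.times (.plus (.const 1) (cell 7 2)) (.plus (.const 1) (cell 7 2)))
        (.plus (.const 1) (cell 7 3))))) (.const 1)

/-- The length of a gadget curve. -/
def lengthExpr (n : NatExpr) : NatExpr :=
  .plus (.times (.const 20) (.minus n (.const 1))) (.const 8)

/-- Compute the parameter, write the gadget curves into the (shifted) input arrays of dynamic DTW,
and preprocess them. -/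
def preprocessCmd (D : DataStructure) : Cmd :=
  .seq (sumLoop 2 (cell 0 0) (.plus (.read 1 (cell 7 1)) (.read 2 (cell 7 1)))) <|
  .seq (sumLoop 3 (cell 0 1) (.read 3 (cell 7 1))) <|
  .seq (.setNat 7 (.const 0) paramExpr) <|
  .seq (.setNat 8 (.const 0) (lengthExpr (cell 0 0))) <|
  .seq (.setNat 8 (.const 1) (lengthExpr (cell 0 1))) <|
  .seq (fillLoop 8 (cell 8 0) (rowExpr₀ (.read 1 idxDiv) (.read 2 idxDiv))
    (rowExpr₁ (.read 1 idxDiv) (.read 2 idxDiv)) (rowExpr₂ (.read 1 idxDiv) (.read 2 idxDiv))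
    (rowExpr₃ (.read 1 idxDiv) (.read 2 idxDiv))) <|
  .seq (fillLoop 9 (cell 8 1) (colExpr₀ (.read 3 idxDiv)) (colExpr₁ (.read 3 idxDiv))
    (colExpr₂ (.read 3 idxDiv) (.read 4 idxDiv)) (colExpr₃ (.read 3 idxDiv) (.read 4 idxDiv))) <|
  D.preprocess.shift 8

/-- Substitute one vertex of `Q`. -/
def substCmd (D : DataStructure) (i : NatExpr) (e : RealExpr) : Cmd :=
  .seq (.setNat 9 (.const 0) i) <| .seq (.setReal 10 (.const 0) e) (D.update.shift 8)

/-- Substitute the third and the fourth vertex of a column gadget, unless the column is the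
last one. -/
def updateCmd (D : DataStructure) : Cmd :=
  .ite (.natLt (.plus (cell 5 0) (.const 1)) (cell 0 1))
    (.seq (substCmd D (.plus (.times (.const 20) (cell 5 0)) (.const 18))
        (colExpr₂ (.read 3 (cell 5 0)) (cell 5 1)))
      (substCmd D (.plus (.times (.const 20) (cell 5 0)) (.const 19))
        (colExpr₃ (.read 3 (cell 5 0)) (cell 5 1))))
    .skip

/-- `|n_r - n_c|` -/
def gapExpr : NatExpr :=
  .plus (.minus (cell 0 0) (cell 0 1)) (.minus (cell 0 1) (cell 0 0))

/-- `min (n_r - 1) (n_c - 1)` -/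
def minExpr : NatExpr :=
  .minus (.minus (cell 0 0) (.const 1)) (.minus (cell 0 0) (cell 0 1))

/-- Query the DTW value and compare the resulting length `L` with the threshold; cell `1` of real
array `0` receives `L - U |n_r - n_c|`. -/
def queryCmd (D : DataStructure) : Cmd :=
  .seq (D.query.shift 8) <|
  .seq (.setReal 0 (.const 1) (.minus (.minus (.read 11 (.const 0))
    (.times (.cast gapExpr) (.plus (.times (.cast (.const 4)) (.cast (paramPow 5)))
      (.times (.cast (.const 10)) (.cast (paramPow 4))))))
    (.times (.times (.cast (.const 4)) (.cast (cell 7 0))) (.cast minExpr)))) <|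
  .seq (.setReal 0 (.const 0) (.plus (.read 0 (.const 1))
    (.times (.cast gapExpr) (.cast (cell 0 2))))) <|
  .ite (.realLt (.read 0 (.const 1)) (.cast (.const 0))) (.setNat 6 (.const 0) (.const 0))
    (.ite (.realLt (.times (.read 0 (.const 1)) (.read 0 (.const 1))) (.cast (cell 0 2)))
      (.setNat 6 (.const 0) (.const 0)) (.setNat 6 (.const 0) (.const 1)))

/-- The data structure for Intermediary that is built from one for dynamic DTW. -/
def reduction (D : DataStructure) : DataStructure where
  preprocess := preprocessCmd D
  update := updateCmd D
  query := queryCmd D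

/-- The invariant of the data structure: its own arrays hold the sizes, the column identifiers, and
the parameter, and the other arrays represent the gadget curves. -/
def Represents (D : DataStructure) (I : Intermediary) (σ : Mem) : Prop :=
  (σ.nat 0 0 = I.nr ∧ σ.nat 0 1 = I.nc ∧ σ.nat 0 2 = I.U ∧ (∀ j, σ.nat 3 j = I.c.getD j 0) ∧
    σ.nat 7 0 = I.param) ∧
  Reaches dynamicDTW D I.curves (σ.view 8)

/-! ### Correctness and running time of the reduction -/

section Correctness

variable {D : DataStructure} {TP TU TQ : ℕ → ℕ → ℕ}

/-- Arrays `0` to `6` form the interface of Intermediary, integer array `7` is scratch space with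
the parameter in cell `0`, and arrays from `8` on belong to `D`. -/
theorem runs_preprocess
    (hD : Solves dynamicDTW D (fun s => TP s.P.length s.Q.length)
      (fun s => TU s.P.length s.Q.length) (fun s => TQ s.P.length s.Q.length))
    (I : Intermediary) :
    Runs (preprocessCmd D) (problem.load I)
      (1000 * (TP (20 * (I.nr - 1) + 8) (20 * (I.nc - 1) + 8) + (20 * (I.nr - 1) + 8) +
        (20 * (I.nc - 1) + 8))) (Represents D I) := by
  have hl0 : (problem.load I).nat 0 0 = I.nr := rfl
  have hl1 : (problem.load I).nat 0 1 = I.nc := rfl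
  have hl2 : (problem.load I).nat 0 2 = I.U := rfl
  have hlr : ∀ i, (problem.load I).nat 1 i = I.r.getD i 0 := fun _ => rfl
  have hld : ∀ i, (problem.load I).nat 2 i = I.d.getD i 0 := fun _ => rfl
  have hlc : ∀ i, (problem.load I).nat 3 i = I.c.getD i 0 := fun _ => rfl
  have hlb : ∀ i, (problem.load I).nat 4 i = (I.b.getD i false).toNat := fun _ => rfl
  have hlz : ∀ a i, 5 ≤ a → (problem.load I).nat a i = 0 := by
    intro a i ha
    simp only [problem]
    rw [if_neg (by omega), if_neg (by omega), if_neg (by omega), if_neg (by omega),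
      if_neg (by omega)]
  have hlre : ∀ a i, (problem.load I).real a i = 0 := fun _ _ => rfl
  generalize problem.load I = σ₀ at *
  -- Every phase is paid from the `1000` steps per curve vertex; each curve has at least eight
  -- vertices, which covers the constants.
  refine Runs.seq (s := 25 * I.nr + 8) (runs_sumLoop (n := I.nr)
    (fun i => I.r.getD i 0 + I.d.getD i 0) (by norm_num) (hlz _ _ (by norm_num)) ?_ ?_ ?_)
    (t := 975 * (20 * (I.nr - 1) + 8) + 1000 * (20 * (I.nc - 1) + 8) +
      TP (20 * (I.nr - 1) + 8) (20 * (I.nc - 1) + 8)) ?_ (by omega)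
  · intro τ hτ
    simp [NatExpr.eval, hτ, hl0]
  · intro τ hτ
    simp [NatExpr.eval, hτ, hlr, hld]
  · simp only [NatExpr.cost]; omega
  rintro σ₁ ⟨r1, s1, n1⟩
  refine Runs.seq (s := 22 * I.nc + 8) (runs_sumLoop (n := I.nc)
    (fun i => I.c.getD i 0) (by norm_num) ?_ ?_ ?_ ?_)
    (t := 975 * (20 * (I.nr - 1) + 8) + 975 * (20 * (I.nc - 1) + 8) +
      TP (20 * (I.nr - 1) + 8) (20 * (I.nc - 1) + 8)) ?_ (by omega)
  · rw [n1 _ _ (by omega), hlz _ _ (by norm_num)]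
  · intro τ hτ
    simp [NatExpr.eval, hτ, n1, hl1]
  · intro τ hτ
    simp [NatExpr.eval, hτ, n1, hlc]
  · simp only [NatExpr.cost]; omega
  rintro σ₂ ⟨r2, s2, n2⟩
  have hpar : paramExpr.eval σ₂ = I.param := by
    simp only [paramExpr, NatExpr.eval]
    rw [s2, n2 7 2 (by omega), s1, n2 0 0 (by omega), n2 0 1 (by omega), n2 0 2 (by omega),
      n1 0 0 (by omega), n1 0 1 (by omega), n1 0 2 (by omega), hl0, hl1, hl2]
    rfl
  have hlow : ∀ a i, a ≤ 6 → σ₂.nat a i = σ₀.nat a i := fun a i ha => by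
    rw [n2 _ _ (by omega), n1 _ _ (by omega)]
  have hhigh : ∀ a i, 8 ≤ a → σ₂.nat a i = 0 := fun a i ha => by
    rw [n2 _ _ (by omega), n1 _ _ (by omega), hlz _ _ (by omega)]
  have hreal : ∀ a i, σ₂.real a i = 0 := fun a i => by rw [r2, r1, hlre]
  refine Runs.seq (s := 50) (R := fun τ => τ = σ₂.setNat 7 0 I.param)
    (Runs.setNat (by simp [paramExpr, NatExpr.cost]) (by rw [hpar]; rfl))
    (t := 960 * (20 * (I.nr - 1) + 8) + 960 * (20 * (I.nc - 1) + 8) +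
      TP (20 * (I.nr - 1) + 8) (20 * (I.nc - 1) + 8)) ?_ (by omega)
  rintro σ₃ h3
  refine Runs.seq (s := 50) (R := fun τ => τ = σ₃.setNat 8 0 (20 * (I.nr - 1) + 8))
    (Runs.setNat (by simp [lengthExpr, NatExpr.cost]) ?_)
    (t := 950 * (20 * (I.nr - 1) + 8) + 950 * (20 * (I.nc - 1) + 8) +
      TP (20 * (I.nr - 1) + 8) (20 * (I.nc - 1) + 8)) ?_ (by omega)
  · simp [lengthExpr, NatExpr.eval, h3, Mem.nat_setNat, hlow, hl0]
  rintro σ₄ h4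
  refine Runs.seq (s := 50) (R := fun τ => τ = σ₄.setNat 8 1 (20 * (I.nc - 1) + 8))
    (Runs.setNat (by simp [lengthExpr, NatExpr.cost]) ?_)
    (t := 940 * (20 * (I.nr - 1) + 8) + 940 * (20 * (I.nc - 1) + 8) +
      TP (20 * (I.nr - 1) + 8) (20 * (I.nc - 1) + 8)) ?_ (by omega)
  · simp [lengthExpr, NatExpr.eval, h3, h4, Mem.nat_setNat, hlow, hl1]
  rintro σ₅ h5
  have m5 : ∀ a i, σ₅.nat a i = if a = 8 ∧ i = 1 then 20 * (I.nc - 1) + 8 else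
      if a = 8 ∧ i = 0 then 20 * (I.nr - 1) + 8 else if a = 7 ∧ i = 0 then I.param else
        σ₂.nat a i := by
    intro a i
    rw [h5, Mem.nat_setNat, h4, Mem.nat_setNat, h3, Mem.nat_setNat]
  have r5 : ∀ a i, σ₅.real a i = 0 := by
    intro a i
    rw [h5, h4, h3]
    exact hreal a i
  clear h3 h4 h5 hpar n1 n2 s1 s2 r1 r2 hlz hlre
  refine Runs.seq (s := 200 * (20 * (I.nr - 1) + 8)) (runs_fillLoop (n := 20 * (I.nr - 1) + 8)
    (V := I.param) (I.rowCore I.param) (by simp [m5]) ?_ ?_ ?_ ?_)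
    (t := 740 * (20 * (I.nr - 1) + 8) + 940 * (20 * (I.nc - 1) + 8) +
      TP (20 * (I.nr - 1) + 8) (20 * (I.nc - 1) + 8)) ?_ (by omega)
  · intro τ hτ
    simp [NatExpr.eval, hτ, m5]
  · intro τ hτ
    refine eval_rowExpr ?_ ?_ ?_
    · simp [hτ, m5]
    · simp [NatExpr.eval, idxDiv, hτ, m5, hlow, hlr]
    · simp [NatExpr.eval, idxDiv, hτ, m5, hlow, hld]
  · refine ⟨?_, ?_, ?_, ?_⟩ <;>
      simp [rowExpr₀, rowExpr₁, rowExpr₂, rowExpr₃, quarter, quartic, cubic, RealExpr.cost,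
        NatExpr.cost, paramPow, idxDiv]
  · simp only [NatExpr.cost]; omega
  rintro σ₆ ⟨r6, n6⟩
  refine Runs.seq (s := 200 * (20 * (I.nc - 1) + 8)) (runs_fillLoop (n := 20 * (I.nc - 1) + 8)
    (V := I.param) (I.colCore I.param) (by simp [n6, m5]) ?_ ?_ ?_ ?_)
    (t := TP (20 * (I.nr - 1) + 8) (20 * (I.nc - 1) + 8)) ?_ (by omega)
  · intro τ hτ
    simp [NatExpr.eval, hτ, n6, m5]
  · intro τ hτ
    refine eval_colExpr ?_ ?_ ?_
    · simp [hτ, n6, m5]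
    · simp [NatExpr.eval, idxDiv, hτ, n6, m5, hlow, hlc]
    · simp [NatExpr.eval, idxDiv, hτ, n6, m5, hlow, hlb]
  · refine ⟨?_, ?_, ?_, ?_⟩ <;>
      simp [colExpr₀, colExpr₁, colExpr₂, colExpr₃, signExpr, quartic, cubic, RealExpr.cost,
        NatExpr.cost, paramPow, idxDiv]
  · simp only [NatExpr.cost]; omega
  rintro σ₇ ⟨r7, n7⟩
  -- `Exec` speaks of exact memories, so the view must be the initial memory of `D` in every cell;
  -- `hhigh` and `r5` supply the zeros.
  have hview : σ₇.view 8 = dynamicDTW.load I.curves := by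
    refine Mem.ext_cells (fun a i => ?_) fun a i => ?_
    · simp only [Mem.view]
      rw [n7 _ _ (by omega), n6 _ _ (by omega), m5]
      simp only [dynamicDTW, length_curves_P, length_curves_Q]
      rcases Nat.eq_zero_or_pos a with rfl | ha
      · match i with
        | 0 => simp
        | 1 => simp
        | i + 2 => simp [hhigh]
      · rw [if_neg (by omega), if_neg (by omega), if_neg (by omega), hhigh _ _ (by omega),
          if_neg (by omega)]
    · simp only [Mem.view]
      rw [r7, r6, r5]
      simp only [dynamicDTW, getD_curves_P, getD_curves_Q]
      rcases a with _ | _ | a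
      · simp
      · simp
      · simp
  obtain ⟨t, τ, e1, e2⟩ := hD.1 I.curves
  obtain ⟨τ', e3, e4, e5⟩ := e1.shift 8 σ₇ hview
  refine ⟨t, τ', e3, ?_, ⟨?_, ?_, ?_, ?_, ?_⟩, ?_⟩
  · simpa only [length_curves_P, length_curves_Q] using e2
  · rw [e5 _ (by norm_num)]; simp [n7, n6, m5, hlow, hl0]
  · rw [e5 _ (by norm_num)]; simp [n7, n6, m5, hlow, hl1]
  · rw [e5 _ (by norm_num)]; simp [n7, n6, m5, hlow, hl2]
  · intro j
    rw [e5 _ (by norm_num)]; simp [n7, n6, m5, hlow, hlc]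
  · rw [e5 _ (by norm_num)]; simp [n7, n6, m5]
  · rw [e4]
    exact Reaches.preprocess e1

/-- The shifted argument arrays are `9 = 1 + 8` and `10 = 2 + 8`. The index is stored first, hence
`e` is evaluated after that write. -/
theorem runs_subst
    (hD : Solves dynamicDTW D (fun s => TP s.P.length s.Q.length)
      (fun s => TU s.P.length s.Q.length) (fun s => TQ s.P.length s.Q.length))
    {s : CurvePair} {σ : Mem} (hs : Reaches dynamicDTW D s (σ.view 8)) {i : NatExpr}
    {e : RealExpr} (u : Fin s.Q.length × ℝ) (hi : i.eval σ = u.1)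
    (he : e.eval (σ.setNat 9 0 u.1) = u.2) :
    Runs (substCmd D i e) σ (i.cost + e.cost + 4 + TU s.P.length s.Q.length) fun τ =>
      Reaches dynamicDTW D (dynamicDTW.apply s u) (τ.view 8) ∧ ∀ a < 8, τ.nat a = σ.nat a := by
  refine Runs.seq (s := i.cost + 2) (R := fun τ => τ = σ.setNat 9 0 u.1)
    (Runs.setNat (by simp only [NatExpr.cost]; omega) (by rw [hi]; rfl))
    (t := e.cost + 2 + TU s.P.length s.Q.length) ?_ (by omega)
  rintro _ rfl
  refine Runs.seq (s := e.cost + 2) (R := fun τ => τ = (σ.setNat 9 0 u.1).setReal 10 0 u.2)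
    (Runs.setReal (by simp only [NatExpr.cost]; omega) (by rw [he]; rfl))
    (t := TU s.P.length s.Q.length) ?_ (by omega)
  rintro _ rfl
  obtain ⟨t, τ, e1, e2⟩ := hD.2.1 s _ hs u
  have hview : ((σ.setNat 9 0 u.1).setReal 10 0 u.2).view 8 = dynamicDTW.pass s u (σ.view 8) := by
    rw [show (10 : ℕ) = 2 + 8 from rfl, Mem.view_setReal, show (9 : ℕ) = 1 + 8 from rfl,
      Mem.view_setNat]
    rfl
  obtain ⟨τ', e3, e4, e5⟩ := e1.shift 8 _ hview
  refine ⟨t, τ', e3, e2, ?_, fun a ha => ?_⟩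
  · rw [e4]
    exact Reaches.update u hs e1
  · rw [e5 a ha]
    funext j
    rw [Mem.nat_setReal, Mem.nat_setNat, if_neg (by omega)]

theorem length_apply_curves {I : Intermediary} {u : Fin I.curves.Q.length × ℝ} :
    (dynamicDTW.apply I.curves u).P.length = 20 * (I.nr - 1) + 8 ∧
    (dynamicDTW.apply I.curves u).Q.length = 20 * (I.nc - 1) + 8 :=
  ⟨I.length_curves_P, by
    rw [← I.length_curves_Q]
    exact List.length_set⟩

theorem runs_update
    (hD : Solves dynamicDTW D (fun s => TP s.P.length s.Q.length)
      (fun s => TU s.P.length s.Q.length) (fun s => TQ s.P.length s.Q.length))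
    {I : Intermediary} {σ : Mem} (hσ : Represents D I σ) (u : Fin I.nc × Bool) :
    Runs (updateCmd D) (problem.pass I u σ)
      (1000 * TU (20 * (I.nr - 1) + 8) (20 * (I.nc - 1) + 8))
      (Represents D (I.setB u.1 u.2)) := by
  obtain ⟨⟨h0, h1, h2, h3, h4⟩, hR⟩ := hσ
  -- `Q` has at least eight vertices, so some substitution exists, and its run takes a step.
  have hTU : 1 ≤ TU (20 * (I.nr - 1) + 8) (20 * (I.nc - 1) + 8) := by
    obtain ⟨t, τ, e1, e2⟩ := hD.2.1 I.curves _ hR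
      ((⟨0, by rw [length_curves_Q]; omega⟩, 0) : Fin I.curves.Q.length × ℝ)
    have := e1.one_le
    simp only [length_curves_P, length_curves_Q] at e2
    omega
  obtain ⟨⟨j, hj⟩, x⟩ := u
  have hp : ∀ a i, (problem.pass I (⟨j, hj⟩, x) σ).nat a i =
      if a = 5 ∧ i = 1 then x.toNat else if a = 5 ∧ i = 0 then j else σ.nat a i := by
    intro a i
    simp only [problem, Mem.nat_setNat]
  have hpv : (problem.pass I (⟨j, hj⟩, x) σ).view 8 = σ.view 8 := by
    simp only [problem]
    rw [Mem.view_setNat_of_lt (by norm_num), Mem.view_setNat_of_lt (by norm_num)]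
  rw [← hpv] at hR
  generalize problem.pass I (⟨j, hj⟩, x) σ = σ' at *
  refine Runs.ite (t := 200 + 2 * TU (20 * (I.nr - 1) + 8) (20 * (I.nc - 1) + 8))
    (fun hb => ?_) (fun hb => ?_) (by simp only [Test.cost, NatExpr.cost]; omega)
  · simp only [Test.Holds, NatExpr.eval, hp] at hb
    simp [h1] at hb
    have hlen := I.length_curves_Q
    refine Runs.seq (runs_subst hD hR (i := .plus (.times (.const 20) (cell 5 0)) (.const 18))
      (e := colExpr₂ (.read 3 (cell 5 0)) (cell 5 1)) (⟨20 * j + 18, by omega⟩,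
        colVal I.param (I.c.getD j 0) x 2) ?_ ?_)
      (t := 100 + TU (20 * (I.nr - 1) + 8) (20 * (I.nc - 1) + 8)) ?_ ?_
    · simp [NatExpr.eval, hp]
    · refine (eval_colExpr ?_ ?_ ?_).2.2.1
      · simp [Mem.nat_setNat, hp, h4]
      · simp [NatExpr.eval, Mem.nat_setNat, hp, h3]
      · simp [NatExpr.eval, Mem.nat_setNat, hp]
    · rintro τ ⟨hτ, hτn⟩
      have hlen' := length_apply_curves (I := I) (u := (⟨20 * j + 18, by omega⟩,
        colVal I.param (I.c.getD j 0) x 2))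
      refine (runs_subst hD hτ (i := .plus (.times (.const 20) (cell 5 0)) (.const 19))
        (e := colExpr₃ (.read 3 (cell 5 0)) (cell 5 1)) (⟨20 * j + 19, by omega⟩,
          colVal I.param (I.c.getD j 0) x 3) ?_ ?_).mono ?_ ?_
      · simp [NatExpr.eval, hτn, hp]
      · refine (eval_colExpr ?_ ?_ ?_).2.2.2
        · simp [Mem.nat_setNat, hτn, hp, h4]
        · simp [NatExpr.eval, Mem.nat_setNat, hτn, hp, h3]
        · simp [NatExpr.eval, Mem.nat_setNat, hτn, hp]
      · rw [hlen'.1, hlen'.2]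
        have : (colExpr₃ (.read 3 (cell 5 0)) (cell 5 1)).cost ≤ 60 := by
          simp [colExpr₃, signExpr, quartic, cubic, RealExpr.cost, NatExpr.cost, paramPow]
        simp only [NatExpr.cost]
        omega
      · rintro υ ⟨hυ, hυn⟩
        have happ := I.apply_apply_curves j x (by omega)
          (⟨20 * j + 18, by omega⟩, colVal I.param (I.c.getD j 0) x 2)
          (⟨20 * j + 19, by
            have := hlen'.2
            omega⟩, colVal I.param (I.c.getD j 0) x 3) rfl rfl rfl rfl
        refine ⟨⟨?_, ?_, ?_, ?_, ?_⟩,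
          Eq.mp (congrArg (fun s => Reaches dynamicDTW D s (υ.view 8)) happ) hυ⟩
        · simp [hυn, hτn, hp, h0]; rfl
        · simp [hυn, hτn, hp, h1]; rfl
        · simp [hυn, hτn, hp, h2]; rfl
        · intro j
          simp [hυn, hτn, hp, h3]; rfl
        · simp [hυn, hτn, hp, h4]; rfl
    · rw [hlen, length_curves_P]
      have : (colExpr₂ (.read 3 (cell 5 0)) (cell 5 1)).cost ≤ 60 := by
        simp [colExpr₂, signExpr, quartic, cubic, RealExpr.cost, NatExpr.cost, paramPow]
      simp only [NatExpr.cost]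
      omega
  -- The last column has no gadget, so its Boolean does not affect the curves.
  · simp only [Test.Holds, NatExpr.eval, hp] at hb
    simp [h1] at hb
    refine ⟨1, σ', .skip _, by omega, ⟨?_, ?_, ?_, ?_, ?_⟩, ?_⟩
    · simp [hp, h0]; rfl
    · simp [hp, h1]; rfl
    · simp [hp, h2]; rfl
    · intro j
      simp [hp, h3]; rfl
    · simp [hp, h4]; rfl
    · have : (I.setB j x).curves = I.curves := by
        refine CurvePair.ext rfl (List.ext_getD_zero ?_ ?_)
        · rw [length_curves_Q, length_curves_Q]; rfl
        · intro i hi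
          rw [length_curves_Q] at hi
          rw [getD_curves_Q, getD_curves_Q, if_pos hi,
            if_pos (show i < 20 * (I.nc - 1) + 8 from hi)]
          change blockVal ((I.param : ℝ) ^ 5) ((I.setB j x).colCore I.param) i = _
          unfold blockVal
          split_ifs with h5
          · rfl
          · change i < 20 * (I.nc - 1) + 8 at hi
            simp only [colCore, setB]
            congr 1
            simp only [List.getD_eq_getElem?_getD]
            rw [List.getElem?_set_ne (by omega)]
      exact this ▸ hR

theorem runs_query
    (hD : Solves dynamicDTW D (fun s => TP s.P.length s.Q.length)
      (fun s => TU s.P.length s.Q.length) (fun s => TQ s.P.length s.Q.length))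
    {I : Intermediary} {σ : Mem} (hσ : Represents D I σ) :
    Runs (queryCmd D) σ (1000 * TQ (20 * (I.nr - 1) + 8) (20 * (I.nc - 1) + 8))
      (fun τ => Represents D I τ ∧ problem.Answers I τ) := by
  obtain ⟨⟨h0, h1, h2, h3, h4⟩, hR⟩ := hσ
  obtain ⟨t, τ, e1, e2, e3⟩ := hD.2.2 I.curves _ hR
  have ht := e1.one_le
  simp only [length_curves_P, length_curves_Q] at e2
  obtain ⟨σ₁, f1, f2, f3⟩ := e1.shift 8 σ rfl
  obtain ⟨v, hv, hans⟩ := I.exists_isDTW_curves I.admissible_param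
  have hv' : σ₁.real 11 0 = v := by
    have : IsDTW I.curves.P I.curves.Q (τ.real 3 0) := e3
    have h := this.unique hv
    rw [← f2] at h
    exact h
  -- After the query of `D`, only real array `0` and integer array `6` are written, neither of which
  -- enters the invariant.
  have hrep : ∀ τ' : Mem, τ'.view 8 = τ → (∀ a < 8, a ≠ 6 → τ'.nat a = σ.nat a) →
      Represents D I τ' := by
    intro τ' hτ' hn
    refine ⟨⟨?_, ?_, ?_, ?_, ?_⟩, ?_⟩
    · rw [hn _ (by norm_num) (by norm_num), h0]
    · rw [hn _ (by norm_num) (by norm_num), h1]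
    · rw [hn _ (by norm_num) (by norm_num), h2]
    · intro j
      rw [hn _ (by norm_num) (by norm_num), h3]
    · rw [hn _ (by norm_num) (by norm_num), h4]
    · rw [hτ']
      exact Reaches.query hR e1
  -- At least one of the two truncated differences vanishes.
  have hgap : gapExpr.eval σ₁ = I.gap := by
    simp only [gapExpr, NatExpr.eval, f3 0 (by norm_num), h0, h1, gap]
    omega
  -- The truncated `n_r - n_c` is subtracted only when there are more rows than columns.
  have hmin : minExpr.eval σ₁ = min (I.nr - 1) (I.nc - 1) := by
    simp only [minExpr, NatExpr.eval, f3 0 (by norm_num), h0, h1]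
    have := I.nr_pos
    have := I.nc_pos
    omega
  set L := v - I.offset I.param with hL
  set y := L - I.U * I.gap with hy
  refine Runs.seq (R := fun τ' => τ' = σ₁) ⟨t, σ₁, f1, e2, rfl⟩ (t := 300) ?_ (by omega)
  rintro _ hτ'
  rw [hτ']
  refine Runs.seq (s := 100) (R := fun τ' => τ' = σ₁.setReal 0 1 y)
    (Runs.setReal (by
      simp [RealExpr.cost, NatExpr.cost, gapExpr, minExpr, paramPow]) ?_) (t := 200) ?_ (by omega)
  · congr 1
    simp only [RealExpr.eval, NatExpr.eval, hgap, hmin, eval_paramPow, f3 7 (by norm_num), h4, hv']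
    rw [hy, hL, offset]
    push_cast
    ring
  rintro _ hτ'
  rw [hτ']
  refine Runs.seq (s := 100) (R := fun τ' => τ' = (σ₁.setReal 0 1 y).setReal 0 0 L)
    (Runs.setReal (by
      simp [RealExpr.cost, NatExpr.cost, gapExpr]) ?_) (t := 100) ?_ (by omega)
  · congr 1
    have hgap' : gapExpr.eval (σ₁.setReal 0 1 y) = I.gap := hgap
    simp only [RealExpr.eval, NatExpr.eval, hgap', Mem.real_setReal, Mem.nat_setReal,
      f3 0 (by norm_num), h2]
    rw [hy]
    simp
    ring
  rintro _ hτ'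
  rw [hτ']
  have hU : (0 : ℝ) ≤ I.U := Nat.cast_nonneg _
  have hfin : ∀ k : ℕ, ((k = 0 ∧ L < I.U * I.gap + √(I.U : ℝ)) ∨
      (k = 1 ∧ ¬ L < I.U * I.gap + √(I.U : ℝ))) →
      Represents D I (((σ₁.setReal 0 1 y).setReal 0 0 L).setNat 6 0 k) ∧
      problem.Answers I (((σ₁.setReal 0 1 y).setReal 0 0 L).setNat 6 0 k) := by
    intro k hk
    refine ⟨hrep _ ?_ ?_, ?_⟩
    · rw [Mem.view_setNat_of_lt (by norm_num), Mem.view_setReal_of_lt (by norm_num),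
        Mem.view_setReal_of_lt (by norm_num), f2]
    · intro a ha ha'
      funext i
      rw [Mem.nat_setNat, if_neg (by omega), Mem.nat_setReal, Mem.nat_setReal, f3 a ha]
    · unfold report at hans
      rcases hk with ⟨rfl, hk⟩ | ⟨rfl, hk⟩
      · rw [if_pos hk] at hans
        right
        refine ⟨by simp [Mem.nat_setNat], ?_⟩
        simpa [Mem.real_setNat, Mem.real_setReal] using hans
      · rw [if_neg hk] at hans
        left
        exact ⟨by simp [Mem.nat_setNat], hans⟩
  have e1 : ((σ₁.setReal 0 1 y).setReal 0 0 L).real 0 1 = y := by simp [Mem.real_setReal]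
  have e2 : ((σ₁.setReal 0 1 y).setReal 0 0 L).nat 0 2 = I.U := by
    rw [Mem.nat_setReal, Mem.nat_setReal, f3 0 (by norm_num), h2]
  -- The threshold reads `y < √U`: true for negative `y`, and equivalent to `y * y < U` otherwise.
  refine Runs.ite (t := 80) (fun hb => ?_) (fun hb => ?_)
    (by simp [Test.cost, RealExpr.cost, NatExpr.cost])
  · simp only [Test.Holds, RealExpr.eval, NatExpr.eval, e1] at hb
    refine Runs.setNat (by simp [NatExpr.cost]) (hfin 0 (Or.inl ⟨rfl, ?_⟩))
    have := Real.sqrt_nonneg (I.U : ℝ)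
    push_cast at hb
    linarith
  simp only [Test.Holds, RealExpr.eval, NatExpr.eval, e1] at hb
  push_cast at hb
  refine Runs.ite (t := 40) (fun hb2 => ?_) (fun hb2 => ?_)
    (by simp [Test.cost, RealExpr.cost, NatExpr.cost])
  · simp only [Test.Holds, RealExpr.eval, NatExpr.eval, e1, e2] at hb2
    refine Runs.setNat (by simp [NatExpr.cost]) (hfin 0 (Or.inl ⟨rfl, ?_⟩))
    have := Real.lt_sqrt_of_sq_lt (x := y) (y := I.U) (by rw [pow_two]; exact hb2)
    linarith
  · simp only [Test.Holds, RealExpr.eval, NatExpr.eval, e1, e2] at hb2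
    refine Runs.setNat (by simp [NatExpr.cost]) (hfin 1 (Or.inr ⟨rfl, ?_⟩))
    intro hlt
    have h5 : y < √(I.U : ℝ) := by linarith
    have h6 := (Real.lt_sqrt (by linarith)).1 h5
    rw [pow_two] at h6
    exact hb2 h6

/-- By `Runs.of_exec`, the runs recorded in `Reaches` are the ones analysed above. -/
theorem represents_of_reaches
    (hD : Solves dynamicDTW D (fun s => TP s.P.length s.Q.length)
      (fun s => TU s.P.length s.Q.length) (fun s => TQ s.P.length s.Q.length))
    {I : problem.State} {σ : Mem} (h : Reaches problem (reduction D) I σ) :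
    Represents D I σ := by
  induction h with
  | preprocess he => exact (runs_preprocess hD _).of_exec he
  | update u _ he ih => exact (runs_update hD ih u).of_exec he
  | query _ he ih => exact ((runs_query hD ih).of_exec he).1

theorem solves_reduction
    (hD : Solves dynamicDTW D (fun s => TP s.P.length s.Q.length)
      (fun s => TU s.P.length s.Q.length) (fun s => TQ s.P.length s.Q.length)) :
    Solves problem (reduction D)
      (fun I => 1000 * (TP (20 * (I.nr - 1) + 8) (20 * (I.nc - 1) + 8) + (20 * (I.nr - 1) + 8) +
        (20 * (I.nc - 1) + 8)))
      (fun I => 1000 * TU (20 * (I.nr - 1) + 8) (20 * (I.nc - 1) + 8))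
      (fun I => 1000 * TQ (20 * (I.nr - 1) + 8) (20 * (I.nc - 1) + 8)) := by
  refine ⟨fun I => ?_, fun I σ h u => ?_, fun I σ h => ?_⟩
  · obtain ⟨t, τ, h1, h2, -⟩ := runs_preprocess hD I
    exact ⟨t, τ, h1, h2⟩
  · obtain ⟨t, τ, h1, h2, -⟩ := runs_update hD (represents_of_reaches hD h) u
    exact ⟨t, τ, h1, h2⟩
  · obtain ⟨t, τ, h1, h2, -, h3⟩ := runs_query hD (represents_of_reaches hD h)
    exact ⟨t, τ, h1, h2, h3⟩

end Correctness

end Intermediary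

/-! ### The main theorem -/

theorem mainTheorem3 :
    ∃ (ν μ : ℕ → ℕ) (C : ℕ),
      (∀ k, 1 ≤ k → ν k ≤ C * k ∧ μ k ≤ C * k) ∧
      (∀ (I : Intermediary) (V : ℕ), I.U ≤ V →
        I.nr * I.nc * (max 1 (listMax I.d) * max 1 (listMax I.r) * max 1 (listMax I.c)) ^ 2 < V →
        (I.curveP V).length = ν I.nr ∧ (I.curveQ V).length = μ I.nc ∧
        ∃ v : ℝ, IsDTW (I.curveP V) (I.curveQ V) v ∧ I.IsAnswer (I.report (v - I.offset V))) ∧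
      (∀ (TP TU TQ : ℕ → ℕ → ℕ) (D : RealRAM.DataStructure),
        RealRAM.Solves dynamicDTW D
          (fun s => TP s.P.length s.Q.length)
          (fun s => TU s.P.length s.Q.length)
          (fun s => TQ s.P.length s.Q.length) →
        ∃ D' : RealRAM.DataStructure,
          RealRAM.Solves Intermediary.problem D'
            (fun I => C * (TP (ν I.nr) (μ I.nc) + ν I.nr + μ I.nc))
            (fun I => C * TU (ν I.nr) (μ I.nc))
            (fun I => C * TQ (ν I.nr) (μ I.nc))) := by
  refine ⟨fun k => 20 * (k - 1) + 8, fun k => 20 * (k - 1) + 8, 1000, fun k hk => ?_,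
    fun I V h₁ h₂ => ?_, fun TP TU TQ D hD => ?_⟩
  · constructor <;> simp only <;> omega
  · exact ⟨I.length_curveP V, I.length_curveQ V, I.exists_isDTW_curves ⟨h₁, h₂⟩⟩
  · exact ⟨_, Intermediary.solves_reduction hD⟩
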